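/- Let $M$ be a connected complete Riemannian manifold, with geodesic distance $d$ and Riemannian measure $\mathrm dx$; write $|E|$ for the measure of $E$, $B(x,r)$ for the open geodesic balls (with $r>0$) and $V(x,r)=|B(x,r)|$. Assume that the measure is doubling: there is a constant $C$ such that $V(x,2r)\le C\,V(x,r)$ for all $x\in M$, $r>0$. For $B=B(x,r)$ and $\alpha>0$ put $\alpha B=B(x,\alpha r)$. Let $\mathcal H$ be a Hilbert space. For a measurable function $F(t,y)=F_t(y)$ on $(0,\infty)\times M$ with values in $\mathcal H$ (modulo equality almost everywhere) put $$\mathcal A F(x)=\left(\int_{\Gamma(x)}|F(t,y)|^2\,\frac{\mathrm dy}{V(x,t)}\frac{\mathrm dt}{t}\right)^{1/2},\qquad \Gamma(x)=\{(t,y): t>0,\ d(x,y)<t\},$$ and let $T^{2,p}$ be the space of all $F$ with $\|F\|_{T^{2,p}}:=\|\mathcal A F\|_{L^p(M)}<\infty$. For an open set $O\subset M$, the tent $T(O)$ is the complement in $(0,\infty)\times M$ of $\bigcup_{x\in M\setminus O}\Gamma(x)$. Put $$\mathcal C F(x)=\sup_{B\ni x}\left(\frac1{|B|}\int_{T(B)}|F(t,y)|^2\,\mathrm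 dy\,\frac{\mathrm dt}{t}\right)^{1/2},\qquad \mathcal M h(x)=\sup_{B\ni x}\frac1{|B|}\int_B |h|,$$ the suprema being over all balls $B$ that contain $x$. **Proposition.** Let $T=(T_t)_{t>0}$ be a linear operator bounded from $L^2$ to $T^{2,2}$. Assume that there are $p>2$, $\alpha>1$ and a constant $C$ such that for every ball $B$ and every $f\in L^2$, with $g:=(1-\chi_{\alpha B})f$, $$\left(\frac1{|B|}\int_B \big(\mathcal A(\chi_{T(B)}\,Tg)\big)^p\right)^{1/p}\le C\left(\inf_{x\in B}\mathcal C(Tf)(x)+\inf_{x\in B}\big(\mathcal M(|f|^2)(x)\big)^{1/2}\right).$$ Then for every $2<q<p$ the operator $T$ is bounded from $L^q$ to $T^{2,q}$; that is, there is a bounded linear operator from $L^q$ to $T^{2,q}$ that coincides with $T$ on $L^2\cap L^q$. -/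

import Mathlib

open MeasureTheory Set Bundle
open scoped ENNReal NNReal Manifold ContDiff Bundle

noncomputable section

namespace TentBound

section Riemannian

variable {n : ℕ} {M : Type*} [TopologicalSpace M] [ChartedSpace (EuclideanSpace ℝ (Fin n)) M]
  [RiemannianBundle (fun x : M ↦ TangentSpace (𝓡 n) x)]

/-- The coordinate vector field `∂_i` of the preferred chart at `x`, at the point with coordinates
`u`: the image of the `i`-th standard basis vector under the differential of the inverse of the
chart. -/
def coordVector (x : M) (u : EuclideanSpace ℝ (Fin n)) (i : Fin n) :
    TangentSpace (𝓡 n) ((extChartAt (𝓡 n) x).symm u) :=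
  let e : TangentSpace (𝓡 n) u := (EuclideanSpace.single i (1 : ℝ) : EuclideanSpace ℝ (Fin n))
  mfderiv (𝓡 n) (𝓡 n) (extChartAt (𝓡 n) x).symm u e

/-- The Gram matrix `g_ij = ⟨∂_i, ∂_j⟩` of the Riemannian metric in the preferred chart at `x`, at
the point with coordinates `u`. -/
def gramMatrix (x : M) (u : EuclideanSpace ℝ (Fin n)) : Matrix (Fin n) (Fin n) ℝ :=
  Matrix.of fun i j ↦ inner ℝ (coordVector x u i) (coordVector x u j)

/-- The measure `√(det g_ij) du` in the preferred chart at `x`, transported to `M` and extended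
by zero outside the domain of the chart. -/
def chartMeasure [MeasurableSpace M] (x : M) : Measure M :=
  ((volume.restrict (extChartAt (𝓡 n) x).target).withDensity
    (fun u ↦ ENNReal.ofReal √((gramMatrix x u).det))).map (extChartAt (𝓡 n) x).symm

variable (n M) in
/-- The Riemannian measure. The measures `√(det g_ij) du` of two charts agree on the intersection
of their domains, and the Riemannian measure is the measure that restricts to each of them, which
is their least upper bound. -/
def riemannianMeasure [MeasurableSpace M] : Measure M := ⨆ x : M, chartMeasure (n := n) x

end Riemannian

section Tent

variable {M : Type*} [MetricSpace M] [MeasurableSpace M]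

/-- `μ` is a doubling measure: balls have positive finite measure, and
`V(x, 2r) ≤ C V(x, r)` for all `x` and all `r > 0`. -/
def IsDoubling (μ : Measure M) : Prop :=
  (∀ (x : M) (r : ℝ), 0 < r → 0 < μ (Metric.ball x r) ∧ μ (Metric.ball x r) < ⊤) ∧
    ∃ C : ℝ≥0, ∀ (x : M) (r : ℝ), 0 < r →
      μ (Metric.ball x (2 * r)) ≤ C * μ (Metric.ball x r)

/-- The cone `Γ(x) = {(t, y) : t > 0, d(x, y) < t}`. -/
def cone (x : M) : Set (ℝ × M) := {z | 0 < z.1 ∧ z.2 ∈ Metric.ball x z.1}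

/-- The tent `T(O)` over `O`: the complement in `(0, ∞) × M` of the union of the cones with vertex
outside `O`. -/
def tent (O : Set M) : Set (ℝ × M) := {z | 0 < z.1} \ ⋃ x ∈ Oᶜ, cone x

/-- The measure `dt/t ⊗ dμ` on `(0, ∞) × M`. -/
def tentMeasure (μ : Measure M) : Measure (ℝ × M) :=
  ((volume.restrict (Ioi (0 : ℝ))).withDensity (fun t ↦ ENNReal.ofReal t⁻¹)).prod μ

variable {H : Type*} [NormedAddCommGroup H]

/-- The area function
`𝒜F(x) = (∫_{Γ(x)} |F(t, y)|² dμ(y) / V(x, t) dt / t)^{1/2}`, with values in `[0, ∞]`. -/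
def area (μ : Measure M) (F : ℝ × M → H) (x : M) : ℝ≥0∞ :=
  (∫⁻ z in cone x, ‖F z‖ₑ ^ 2 / μ (Metric.ball x z.1) ∂(tentMeasure μ)) ^ (1 / 2 : ℝ)

/-- The function
`𝒞F(x) = sup (1 / μ(B) ∫_{T(B)} |F(t, y)|² dμ(y) dt / t)^{1/2}`, the supremum being over all open
balls `B` that contain `x`. -/
def carleson (μ : Measure M) (F : ℝ × M → H) (x : M) : ℝ≥0∞ :=
  ⨆ (c : M) (r : ℝ) (_ : x ∈ Metric.ball c r),
    ((∫⁻ z in tent (Metric.ball c r), ‖F z‖ₑ ^ 2 ∂(tentMeasure μ)) /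
      μ (Metric.ball c r)) ^ (1 / 2 : ℝ)

/-- The (uncentered) Hardy-Littlewood maximal function of a nonnegative function. -/
def maximal (μ : Measure M) (h : M → ℝ≥0∞) (x : M) : ℝ≥0∞ :=
  ⨆ (c : M) (r : ℝ) (_ : x ∈ Metric.ball c r),
    (∫⁻ y in Metric.ball c r, h y ∂μ) / μ (Metric.ball c r)

variable (H) in
/-- Measurable families `F = (F_t)_{t > 0}` of functions from `M` to `H`, modulo equality almost
everywhere on `(0, ∞) × M`. -/
abbrev TentFun (μ : Measure M) := (ℝ × M) →ₘ[tentMeasure μ] H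

/-- The norm `‖F‖_{T^{2,p}} = ‖𝒜F‖_{L^p}`, with values in `[0, ∞]`. The tent space `T^{2,p}` is the
set of all `F` for which it is finite. -/
def tentNorm {μ : Measure M} (p : ℝ≥0∞) (F : TentFun H μ) : ℝ≥0∞ := eLpNorm (area μ F) p μ

variable {𝕜 : Type*} [RCLike 𝕜] [InnerProductSpace 𝕜 H]

/-- The linear operator `T`, defined on all of `L^p`, is bounded from `L^p` to `T^{2,p}`. -/
def IsBoundedToTent {μ : Measure M} {p : ℝ≥0∞} (T : Lp 𝕜 p μ →ₗ[𝕜] TentFun H μ) : Prop :=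
  ∃ C : ℝ≥0, ∀ f : Lp 𝕜 p μ, tentNorm p (T f) ≤ C * ‖f‖ₑ

/-- The linear operator `T`, defined on `L^2`, is bounded from `L^q` to `T^{2,q}`: there is a bounded
linear operator from all of `L^q` to `T^{2,q}` that coincides with `T` on `L^2 ∩ L^q`. -/
def ExtendsBoundedly {μ : Measure M} (T : Lp 𝕜 2 μ →ₗ[𝕜] TentFun H μ) (q : ℝ≥0∞) : Prop :=
  ∃ S : Lp 𝕜 q μ →ₗ[𝕜] TentFun H μ, IsBoundedToTent S ∧
    ∀ (f : Lp 𝕜 2 μ) (g : Lp 𝕜 q μ), f =ᵐ[μ] g → S g = T f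

variable [BorelSpace M]

/-- The function `(1 - χ_B) f` in `L^2`, for the ball `B` of center `x` and radius `r`. -/
def cutOff {μ : Measure M} (f : Lp 𝕜 2 μ) (x : M) (r : ℝ) : Lp 𝕜 2 μ :=
  ((Lp.memLp f).indicator (measurableSet_ball (x := x) (ε := r)).compl).toLp _

/-- The local estimate: there is a constant `C` such that for every ball `B` and every `f` in `L^2`,
with `g = (1 - χ_{αB}) f`,
`(1 / |B| ∫_B 𝒜(χ_{T(B)} Tg)^p)^{1/p} ≤ C (inf_B 𝒞(Tf) + inf_B (ℳ(|f|²))^{1/2})`. -/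
def LocalEstimate {μ : Measure M} (T : Lp 𝕜 2 μ →ₗ[𝕜] TentFun H μ) (p α : ℝ) : Prop :=
  ∃ C : ℝ≥0, ∀ (x : M) (r : ℝ), 0 < r → ∀ f : Lp 𝕜 2 μ,
    ((∫⁻ y in Metric.ball x r,
        area μ ((tent (Metric.ball x r)).indicator (T (cutOff f x (α * r)))) y ^ p ∂μ) /
      μ (Metric.ball x r)) ^ (1 / p) ≤
    C * ((⨅ y ∈ Metric.ball x r, carleson μ (T f) y) +
      ⨅ y ∈ Metric.ball x r, maximal μ (fun w ↦ ‖f w‖ₑ ^ 2) y ^ (1 / 2 : ℝ))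

end Tent

end TentBound

end

/-! Everything is done with squares. A function `F` enters only through the measure `|F|² dμ dt/t`
on the half space (`energy`); `sqArea` and `sqCarleson` of this measure are the squares of the area
function and of the Carleson function. With `φ = |f|²`, `Q = q/2` and `P = p/2`, so that `1 < Q <
P`, the a priori estimate says that `∫ sqArea ^ Q` is controlled by `∫ φ ^ Q` for `f` in `L²`.

Two inequalities give it. The first, `lintegral_sqArea_rpow_le`, passes from the area function to
the Carleson function in `L^Q`. It follows by duality from Carleson's inequality, which bounds `∫ 𝒜²
h` by a multiple of `∫ 𝒞² ℳh`, and from the maximal theorem in the dual exponent.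

The second, `lintegral_sqCarleson_rpow_le`, bounds the Carleson function by `φ` through a good-λ
inequality: the set where `𝒞² > K s` and `ℳφ ≤ γ s` has measure at most a constant times `γ +
K^(-P)` times that of `{𝒞² > s}`. The work is on one Whitney ball of `{𝒞² > s}`
(`measure_whitney_le`). On a ball `B` around it, `f` is split at `αB`. The inner part is handled by
the `L²` bound of `T` and a weak type (1,1) estimate, which produces `γ`; the outer part by the
local hypothesis and a weak type (P,P) estimate, which produces `K^(-P)`. Integration over the
levels costs `K^Q`. Since `Q < P`, a large `K` and then a small `γ` leave the factor `1/2`, which is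
absorbed after truncation.

For the extension, `f` in `L^q` is cut off to balls. The images are Cauchy by the a priori estimate,
and tent spaces are complete because their norm controls `L²` on tents over balls. -/

namespace TentBound

open Metric Filter Topology

set_option linter.unusedSectionVars false

/-! ### Doubling measures, Vitali and Whitney coverings, weak type (1,1). -/

section Doubling

variable {M : Type*} [MetricSpace M] [MeasurableSpace M] {μ : Measure M} {D : ℝ≥0∞}

/-- `μ` is a doubling measure with doubling constant `D`. -/
structure DoublingWith (μ : Measure M) (D : ℝ≥0∞) : Prop where
  one_le : 1 ≤ D
  ne_top : D ≠ ⊤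
  ne_zero : ∀ (x : M) (r : ℝ), 0 < r → μ (ball x r) ≠ 0
  finite : ∀ (x : M) (r : ℝ), μ (ball x r) ≠ ⊤
  double : ∀ (x : M) (r : ℝ), 0 < r → μ (ball x (2 * r)) ≤ D * μ (ball x r)

theorem IsDoubling.exists_doublingWith (h : IsDoubling μ) : ∃ D, DoublingWith μ D := by
  obtain ⟨h1, C, hC⟩ := h
  refine ⟨1 + C, le_self_add, by simp, fun x r hr ↦ (h1 x r hr).1.ne', fun x r ↦ ?_,
    fun x r hr ↦ (hC x r hr).trans ?_⟩
  · rcases le_or_gt r 0 with hr | hr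
    · simp [ball_eq_empty.2 hr]
    · exact (h1 x r hr).2.ne
  · gcongr
    exact le_add_self

namespace DoublingWith

theorem pow_ne_top (h : DoublingWith μ D) (k : ℕ) : D ^ k ≠ ⊤ := ENNReal.pow_ne_top h.ne_top

theorem one_le_pow (h : DoublingWith μ D) (k : ℕ) : 1 ≤ D ^ k := one_le_pow₀ h.one_le

theorem measure_ball_two_pow (h : DoublingWith μ D) (x : M) {r : ℝ} (hr : 0 < r) (k : ℕ) :
    μ (ball x (2 ^ k * r)) ≤ D ^ k * μ (ball x r) := by
  induction k with
  | zero => simp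
  | succ k ih =>
    calc μ (ball x (2 ^ (k + 1) * r)) = μ (ball x (2 * (2 ^ k * r))) := by ring_nf
      _ ≤ D * μ (ball x (2 ^ k * r)) := h.double _ _ (by positivity)
      _ ≤ D * (D ^ k * μ (ball x r)) := by gcongr
      _ = D ^ (k + 1) * μ (ball x r) := by ring

theorem measure_ball_le (h : DoublingWith μ D) {x y : M} {r s : ℝ} (hr : 0 < r) (k : ℕ)
    (hs : s + dist y x ≤ 2 ^ k * r) : μ (ball y s) ≤ D ^ k * μ (ball x r) :=
  (measure_mono (ball_subset_ball' hs)).trans (h.measure_ball_two_pow x hr k)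

theorem sigmaFinite (h : DoublingWith μ D) [BorelSpace M] : SigmaFinite μ := by
  rcases isEmpty_or_nonempty M with hM | ⟨⟨x⟩⟩
  · have : μ = 0 := Measure.eq_zero_of_isEmpty μ
    rw [this]; infer_instance
  · refine ⟨⟨⟨fun n ↦ ball x n, fun _ ↦ trivial, fun n ↦ (h.finite x n).lt_top, ?_⟩⟩⟩
    exact iUnion_ball_nat x

end DoublingWith

/-- Vitali's covering lemma for a family of balls, given by their centers and radii. -/
theorem exists_disjoint_subfamily [SecondCountableTopology M] (S : Set (M × ℝ)) (R : ℝ)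
    (hS : ∀ s ∈ S, 0 < s.2 ∧ s.2 ≤ R) :
    ∃ u ⊆ S, u.Countable ∧ u.PairwiseDisjoint (fun s ↦ ball s.1 s.2) ∧
      ∀ a ∈ S, ∃ b ∈ u, closedBall a.1 a.2 ⊆ closedBall b.1 (5 * b.2) := by
  obtain ⟨u, hu, hd, hc⟩ := Vitali.exists_disjoint_subfamily_covering_enlargement_closedBall
    S Prod.fst Prod.snd R (fun a ha ↦ (hS a ha).2) 5 (by norm_num)
  have hd' : u.PairwiseDisjoint (fun s ↦ ball s.1 s.2) :=
    fun a ha b hb hab ↦ (hd ha hb hab).mono ball_subset_closedBall ball_subset_closedBall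
  exact ⟨u, hu, hd'.countable_of_isOpen (fun _ _ ↦ isOpen_ball)
    fun a ha ↦ nonempty_ball.2 (hS a (hu ha)).1, hd', hc⟩

/-- A Whitney type covering of the part of an open set that is at bounded distance from the
complement. -/
theorem exists_whitney_cover [SecondCountableTopology M] {O A : Set M} (hO : IsOpen O)
    (hne : Oᶜ.Nonempty) (hA : A ⊆ O) (R : ℝ) (hR : ∀ y ∈ A, infDist y Oᶜ ≤ R) :
    ∃ u ⊆ A, u.Countable ∧ u.PairwiseDisjoint (fun b ↦ ball b (infDist b Oᶜ / 10)) ∧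
      (∀ b ∈ u, 0 < infDist b Oᶜ) ∧ (∀ b ∈ u, ball b (infDist b Oᶜ / 10) ⊆ O) ∧
      ∀ y ∈ A, ∃ b ∈ u, dist y b ≤ infDist b Oᶜ / 2 := by
  have hpos : ∀ y ∈ A, 0 < infDist y Oᶜ := fun y hy ↦
    (hO.isClosed_compl.notMem_iff_infDist_pos hne).1 (by simpa using hA hy)
  -- One tenth of the distance: Vitali's fivefold enlargement is then half of the distance.
  obtain ⟨u, hu, huc, hd, hcov⟩ := exists_disjoint_subfamily
    ((fun y : M ↦ (y, infDist y Oᶜ / 10)) '' A) R (by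
      rintro _ ⟨y, hy, rfl⟩
      have h1 := hpos y hy
      have h2 := hR y hy
      exact ⟨by positivity, by dsimp only; linarith⟩)
  have hu' : ∀ b ∈ u, b.1 ∈ A ∧ b.2 = infDist b.1 Oᶜ / 10 := by
    intro b hb
    obtain ⟨y, hy, rfl⟩ := hu hb
    exact ⟨hy, rfl⟩
  refine ⟨Prod.fst '' u, ?_, huc.image _, ?_, ?_, ?_, ?_⟩
  · rintro _ ⟨b, hb, rfl⟩
    exact (hu' b hb).1
  · rintro _ ⟨a, ha, rfl⟩ _ ⟨b, hb, rfl⟩ hab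
    have := hd ha hb (fun h ↦ hab (by rw [h]))
    simpa only [Function.onFun, (hu' a ha).2, (hu' b hb).2] using this
  · rintro _ ⟨b, hb, rfl⟩
    exact hpos _ (hu' b hb).1
  · rintro _ ⟨b, hb, rfl⟩
    have := hpos _ (hu' b hb).1
    exact (ball_subset_ball (by linarith)).trans ball_infDist_compl_subset
  · intro y hy
    obtain ⟨b, hb, h⟩ := hcov _ (mem_image_of_mem _ hy)
    refine ⟨b.1, mem_image_of_mem _ hb, ?_⟩
    have h1 := hpos y hy
    have := h (mem_closedBall_self (by dsimp only; positivity))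
    rw [mem_closedBall, (hu' b hb).2] at this
    dsimp only at this
    linarith

/-- The supremum of `φ(c, r) / μ(B(c, r))` over all balls `B(c, r)` that contain `x`. -/
noncomputable def ballSup (μ : Measure M) (φ : M → ℝ → ℝ≥0∞) (x : M) : ℝ≥0∞ :=
  ⨆ (c : M) (r : ℝ) (_ : x ∈ ball c r), φ c r / μ (ball c r)

theorem maximal_eq_ballSup (μ : Measure M) (h : M → ℝ≥0∞) :
    maximal μ h = ballSup μ fun c r ↦ ∫⁻ y in ball c r, h y ∂μ := rfl

theorem lt_ballSup_iff {φ : M → ℝ → ℝ≥0∞} {s : ℝ≥0∞} {x : M} :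
    s < ballSup μ φ x ↔ ∃ c r, x ∈ ball c r ∧ s < φ c r / μ (ball c r) := by
  simp only [ballSup, lt_iSup_iff, exists_prop]

theorem le_ballSup (φ : M → ℝ → ℝ≥0∞) {x c : M} {r : ℝ} (hx : x ∈ ball c r) :
    φ c r / μ (ball c r) ≤ ballSup μ φ x :=
  le_iSup₂_of_le c r (le_iSup_of_le hx le_rfl)

theorem isOpen_lt_ballSup (μ : Measure M) (φ : M → ℝ → ℝ≥0∞) (s : ℝ≥0∞) :
    IsOpen {x | s < ballSup μ φ x} := by
  simp only [lt_ballSup_iff, isOpen_iff_mem_nhds]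
  rintro x ⟨c, r, hx, h⟩
  filter_upwards [isOpen_ball.mem_nhds hx] with y hy
  exact ⟨c, r, hy, h⟩

theorem measurable_ballSup [BorelSpace M] (μ : Measure M) (φ : M → ℝ → ℝ≥0∞) :
    Measurable (ballSup μ φ) :=
  measurable_of_Ioi fun s ↦ (isOpen_lt_ballSup μ φ s).measurableSet

theorem DoublingWith.le_ballSup_mul (h : DoublingWith μ D) (φ : M → ℝ → ℝ≥0∞) {x c : M} {r : ℝ}
    (hx : x ∈ ball c r) : φ c r ≤ ballSup μ φ x * μ (ball c r) := by
  have hr : 0 < r := pos_of_mem_ball hx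
  rw [← ENNReal.div_le_iff (h.ne_zero c r hr) (h.finite c r)]
  exact le_ballSup φ hx

theorem DoublingWith.lt_div_iff (h : DoublingWith μ D) {a s : ℝ≥0∞} {c : M} {r : ℝ} (hr : 0 < r) :
    s < a / μ (ball c r) ↔ s * μ (ball c r) < a :=
  ENNReal.lt_div_iff_mul_lt (Or.inl (h.ne_zero c r hr)) (Or.inl (h.finite c r))

/-- Vitali's lemma picks disjoint balls on which `φ`, hence `ν`, is large compared with `μ`. Their
fivefold closed enlargements lie in the eightfold open balls, which accounts for `D ^ 3`. Stated for
a general `φ` so that it serves both the maximal function and the Carleson function. -/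
theorem DoublingWith.weak_type [BorelSpace M] [SecondCountableTopology M] (h : DoublingWith μ D)
    {φ : M → ℝ → ℝ≥0∞} {ν : Measure M} (hφ : ∀ c r, φ c r ≤ ν (ball c r)) (s : ℝ≥0∞) :
    s * μ {x | s < ballSup μ φ x} ≤ D ^ 3 * ν univ := by
  -- Vitali's lemma needs bounded radii, so they are capped at `R`, and the increasing union over
  -- `R` is taken.
  set A : ℕ → Set M := fun R ↦
    {x | ∃ (c : M) (r : ℝ), r ≤ R ∧ x ∈ ball c r ∧ s < φ c r / μ (ball c r)} with hA
  have hun : {x | s < ballSup μ φ x} = ⋃ R, A R := by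
    ext x
    simp only [mem_ofPred_eq, lt_ballSup_iff, hA, mem_iUnion]
    constructor
    · rintro ⟨c, r, hx, hs⟩
      obtain ⟨R, hR⟩ := exists_nat_ge r
      exact ⟨R, c, r, hR, hx, hs⟩
    · rintro ⟨R, c, r, -, hx, hs⟩
      exact ⟨c, r, hx, hs⟩
  have hmono : Monotone A := by
    rintro R R' hR x ⟨c, r, h1, h2⟩
    exact ⟨c, r, h1.trans (by exact_mod_cast hR), h2⟩
  rw [hun, hmono.measure_iUnion, ENNReal.mul_iSup]
  refine iSup_le fun R ↦ ?_
  obtain ⟨u, hu, huc, hd, hcov⟩ := exists_disjoint_subfamily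
    {b : M × ℝ | 0 < b.2 ∧ b.2 ≤ R ∧ s < φ b.1 b.2 / μ (ball b.1 b.2)} R
    (fun b hb ↦ ⟨hb.1, hb.2.1⟩)
  have hsub : A R ⊆ ⋃ b ∈ u, ball b.1 (2 ^ 3 * b.2) := by
    rintro x ⟨c, r, hr, hx, hs⟩
    obtain ⟨b, hb, hsub⟩ := hcov (c, r) ⟨pos_of_mem_ball hx, hr, hs⟩
    refine mem_biUnion hb ?_
    have := mem_closedBall.1 (hsub (ball_subset_closedBall hx))
    have := (hu hb).1
    rw [mem_ball]
    linarith
  calc s * μ (A R) ≤ s * ∑' b : u, μ (ball b.1.1 (2 ^ 3 * b.1.2)) := by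
        gcongr
        exact (measure_mono hsub).trans (measure_biUnion_le μ huc _)
    _ = ∑' b : u, s * μ (ball b.1.1 (2 ^ 3 * b.1.2)) := ENNReal.tsum_mul_left.symm
    _ ≤ ∑' b : u, D ^ 3 * ν (ball b.1.1 b.1.2) := by
        refine ENNReal.tsum_le_tsum fun b ↦ ?_
        obtain ⟨hb, -, hs⟩ := hu b.2
        calc _ ≤ s * (D ^ 3 * μ (ball b.1.1 b.1.2)) := by
              gcongr
              exact h.measure_ball_two_pow _ hb 3
          _ = D ^ 3 * (s * μ (ball b.1.1 b.1.2)) := by ring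
          _ ≤ _ := by
              gcongr
              exact ((h.lt_div_iff hb).1 hs).le.trans (hφ _ _)
    _ = D ^ 3 * ν (⋃ b ∈ u, ball b.1 b.2) := by
        rw [ENNReal.tsum_mul_left, measure_biUnion huc hd fun _ _ ↦ measurableSet_ball]
    _ ≤ _ := by
        gcongr
        exact subset_univ _

theorem DoublingWith.weak_type_maximal [BorelSpace M] [SecondCountableTopology M]
    (h : DoublingWith μ D) (f : M → ℝ≥0∞) (s : ℝ≥0∞) :
    s * μ {x | s < maximal μ f x} ≤ D ^ 3 * ∫⁻ x, f x ∂μ := by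
  rw [maximal_eq_ballSup, ← setLIntegral_univ, ← withDensity_apply _ MeasurableSet.univ]
  exact h.weak_type (fun c r ↦ (withDensity_apply _ measurableSet_ball).ge) s

end Doubling

/-! ### Layer cake formulas in `[0, ∞]`. -/

section LayerCake

/-- For finite `c` this is the real layer cake formula for a constant function on a Dirac mass. For
`c = ⊤` the right side dominates every finite case, hence is infinite. -/
theorem rpow_eq_lintegral {q : ℝ} (hq : 0 < q) (c : ℝ≥0∞) :
    c ^ q = ∫⁻ t in Ioi (0 : ℝ),
      {t : ℝ | ENNReal.ofReal t < c}.indicator (fun t ↦ ENNReal.ofReal (q * t ^ (q - 1))) t := by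
  have hfin : ∀ a : ℝ≥0, (a : ℝ≥0∞) ^ q = ∫⁻ t in Ioi (0 : ℝ), {t : ℝ | ENNReal.ofReal t < a}.indicator
      (fun t ↦ ENNReal.ofReal (q * t ^ (q - 1))) t := by
    intro a
    have := lintegral_rpow_eq_lintegral_meas_lt_mul (Measure.dirac ()) (f := fun _ ↦ (a : ℝ))
      (Eventually.of_forall fun _ ↦ a.2) aemeasurable_const hq
    rw [lintegral_dirac, ← lintegral_const_mul' _ _ ENNReal.ofReal_ne_top] at this
    rw [← ENNReal.ofReal_coe_nnreal, ENNReal.ofReal_rpow_of_nonneg a.coe_nonneg hq.le, this]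
    refine setLIntegral_congr_fun measurableSet_Ioi fun t ht ↦ ?_
    have ht : 0 < t := ht
    by_cases hta : t < a
    · have : t ∈ {t : ℝ | ENNReal.ofReal t < ENNReal.ofReal a} :=
        (ENNReal.ofReal_lt_ofReal_iff (ht.trans hta)).2 hta
      simp only [hta, indicator_of_mem this, ofPred_true, measure_univ, one_mul]
      rw [ENNReal.ofReal_mul hq.le]
    · have : t ∉ {t : ℝ | ENNReal.ofReal t < ENNReal.ofReal a} := fun h ↦
        hta ((ENNReal.ofReal_lt_ofReal_iff_of_nonneg ht.le).1 h)
      rw [indicator_of_notMem this]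
      simp [hta]
  induction c with
  | coe a => exact hfin a
  | top =>
    rw [ENNReal.top_rpow_of_pos hq]
    refine (ENNReal.eq_top_of_forall_nnreal_le fun r ↦ ?_).symm
    calc (r : ℝ≥0∞) = ((r ^ q⁻¹ : ℝ≥0) : ℝ≥0∞) ^ q := by
          rw [ENNReal.coe_rpow_of_nonneg _ (by positivity), ← ENNReal.rpow_mul,
            inv_mul_cancel₀ hq.ne', ENNReal.rpow_one]
      _ ≤ _ := by
          rw [hfin]
          refine lintegral_mono fun t ↦ indicator_le_indicator_of_subset ?_ (fun _ ↦ zero_le) t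
          exact fun t _ ↦ ENNReal.ofReal_lt_top

variable {X : Type*} [MeasurableSpace X]

/-- The layer cake formula for functions with values in `[0, ∞]`. -/
theorem lintegral_rpow_eq_layercake (ν : Measure X) [SFinite ν] {g : X → ℝ≥0∞}
    (hg : Measurable g) {q : ℝ} (hq : 0 < q) :
    ∫⁻ x, g x ^ q ∂ν =
      ∫⁻ t in Ioi (0 : ℝ), ENNReal.ofReal (q * t ^ (q - 1)) * ν {x | ENNReal.ofReal t < g x} := by
  have hm : MeasurableSet {z : X × ℝ | ENNReal.ofReal z.2 < g z.1} :=
    measurableSet_lt (by fun_prop) (by fun_prop)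
  have hw : Measurable fun z : X × ℝ ↦ ENNReal.ofReal (q * z.2 ^ (q - 1)) := by fun_prop
  calc ∫⁻ x, g x ^ q ∂ν = ∫⁻ x, (∫⁻ t in Ioi (0 : ℝ), {z : X × ℝ | ENNReal.ofReal z.2 < g z.1}.indicator
        (fun z ↦ ENNReal.ofReal (q * z.2 ^ (q - 1))) (x, t)) ∂ν := by
        refine lintegral_congr fun x ↦ ?_
        rw [rpow_eq_lintegral hq]
        rfl
    _ = ∫⁻ t in Ioi (0 : ℝ), ∫⁻ x, {z : X × ℝ | ENNReal.ofReal z.2 < g z.1}.indicator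
        (fun z ↦ ENNReal.ofReal (q * z.2 ^ (q - 1))) (x, t) ∂ν :=
        lintegral_lintegral_swap ((hw.indicator hm).aemeasurable)
    _ = _ := by
        refine lintegral_congr fun t ↦ ?_
        have : ∀ x, {z : X × ℝ | ENNReal.ofReal z.2 < g z.1}.indicator
            (fun z ↦ ENNReal.ofReal (q * z.2 ^ (q - 1))) (x, t) =
            {x | ENNReal.ofReal t < g x}.indicator
              (fun _ ↦ ENNReal.ofReal (q * t ^ (q - 1))) x := fun x ↦ rfl
        simp only [this]
        rw [lintegral_indicator_const (measurableSet_lt (by fun_prop) hg)]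

end LayerCake

/-! ### Reduction of integral bounds to truncated functions. -/

section Truncation

variable {X : Type*} [MeasurableSpace X]

/-- Fatou's lemma. Absorbing a term into the left side requires finite integrals; this allows it to
be done for bounded, localized truncations with a uniform constant. -/
theorem lintegral_rpow_le_of_truncated (ν : Measure X) {g : X → ℝ≥0∞} (hg : Measurable g)
    {B : ℕ → Set X} (hB : ∀ N, MeasurableSet (B N)) (hB' : ∀ x, ∀ᶠ N in atTop, x ∈ B N)
    {q : ℝ} {K : ℝ≥0∞}
    (hK : ∀ N : ℕ, ∫⁻ x, (B N).indicator (fun x ↦ min (g x) N) x ^ q ∂ν ≤ K) :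
    ∫⁻ x, g x ^ q ∂ν ≤ K := by
  have hlim : ∀ x, Tendsto (fun N : ℕ ↦ (B N).indicator (fun x ↦ min (g x) N) x ^ q) atTop
      (𝓝 (g x ^ q)) := by
    intro x
    refine (ENNReal.continuous_rpow_const.tendsto _).comp ?_
    have h1 : Tendsto (fun N : ℕ ↦ min (g x) N) atTop (𝓝 (min (g x) ⊤)) :=
      tendsto_const_nhds.min ENNReal.tendsto_nat_nhds_top
    rw [min_eq_left le_top] at h1
    refine h1.congr' ?_
    filter_upwards [hB' x] with N hN
    rw [indicator_of_mem hN]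
  calc ∫⁻ x, g x ^ q ∂ν
      = ∫⁻ x, liminf (fun N : ℕ ↦ (B N).indicator (fun x ↦ min (g x) N) x ^ q) atTop ∂ν :=
        lintegral_congr fun x ↦ (hlim x).liminf_eq.symm
    _ ≤ liminf (fun N : ℕ ↦ ∫⁻ x, (B N).indicator (fun x ↦ min (g x) N) x ^ q ∂ν) atTop :=
        lintegral_liminf_le fun N ↦ ((hg.min measurable_const).indicator (hB N)).pow_const q
    _ ≤ K := (liminf_le_liminf (Eventually.of_forall hK)).trans (by simp)

end Truncation

/-! ### The Hardy-Littlewood maximal theorem. -/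

section Maximal

variable {M : Type*} [MetricSpace M] [MeasurableSpace M] [BorelSpace M]
  [SecondCountableTopology M] {μ : Measure M} {D : ℝ≥0∞}

theorem maximal_le_add (h : DoublingWith μ D) {f g : M → ℝ≥0∞} {s : ℝ≥0∞}
    (hfg : ∀ x, f x ≤ g x + s) (x : M) : maximal μ f x ≤ maximal μ g x + s := by
  refine iSup_le fun c ↦ iSup_le fun r ↦ iSup_le fun hx ↦ ?_
  have hr := pos_of_mem_ball hx
  rw [ENNReal.div_le_iff (h.ne_zero c r hr) (h.finite c r), add_mul]
  calc ∫⁻ y in ball c r, f y ∂μ ≤ ∫⁻ y in ball c r, (g y + s) ∂μ := lintegral_mono hfg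
    _ = ∫⁻ y in ball c r, g y ∂μ + s * μ (ball c r) := by
        rw [lintegral_add_right _ measurable_const, setLIntegral_const]
    _ ≤ _ := by
        gcongr
        exact h.le_ballSup_mul (fun c r ↦ ∫⁻ y in ball c r, g y ∂μ) hx

/-- The maximal function is bounded on `L^r` for `r > 1`. -/
theorem DoublingWith.lintegral_maximal_rpow_le (h : DoublingWith μ D) {r : ℝ} (hr : 1 < r) :
    ∃ C : ℝ≥0∞, C ≠ ⊤ ∧ ∀ f : M → ℝ≥0∞, Measurable f →
      ∫⁻ x, maximal μ f x ^ r ∂μ ≤ C * ∫⁻ x, f x ^ r ∂μ := by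
  have := h.sigmaFinite
  have hr1 : 0 < r - 1 := by linarith
  refine ⟨D ^ 3 * ENNReal.ofReal (2 * r / (r - 1)) * 2 ^ (r - 1), ?_, fun f hf ↦ ?_⟩
  · exact ENNReal.mul_ne_top (ENNReal.mul_ne_top (h.pow_ne_top 3) ENNReal.ofReal_ne_top)
      (ENNReal.rpow_ne_top_of_nonneg hr1.le (by simp))
  have key : ∀ t ∈ Ioi (0 : ℝ), ENNReal.ofReal (r * t ^ (r - 1)) *
      μ {x | ENNReal.ofReal t < maximal μ f x} ≤
      D ^ 3 * ENNReal.ofReal (2 * r / (r - 1)) * (ENNReal.ofReal ((r - 1) * t ^ (r - 1 - 1)) *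
        μ.withDensity f {x | ENNReal.ofReal t < 2 * f x}) := by
    intro t ht
    have ht : 0 < t := ht
    -- Outside `A` the values of `f` are at most `t / 2` and contribute at most `t / 2` to the
    -- maximal function; the weak type bound is needed only for `f` on `A`, at height `t / 2`.
    set A : Set M := {x | ENNReal.ofReal t < 2 * f x} with hA
    have hAm : MeasurableSet A := measurableSet_lt measurable_const (by fun_prop)
    have ht2 : ENNReal.ofReal t = ENNReal.ofReal (t / 2) + ENNReal.ofReal (t / 2) := by
      rw [← ENNReal.ofReal_add (by positivity) (by positivity)]
      ring_nf
    have hle : ∀ x, f x ≤ A.indicator f x + ENNReal.ofReal (t / 2) := by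
      intro x
      by_cases hx : x ∈ A
      · rw [indicator_of_mem hx]; exact le_self_add
      · rw [indicator_of_notMem hx, zero_add]
        have : 2 * f x ≤ ENNReal.ofReal t := not_lt.1 hx
        rw [ht2, ← two_mul] at this
        exact (ENNReal.mul_le_mul_iff_right (by simp) (by simp)).1 this
    have hsub : {x | ENNReal.ofReal t < maximal μ f x} ⊆
        {x | ENNReal.ofReal (t / 2) < maximal μ (A.indicator f) x} := by
      intro x hx
      have h1 : ENNReal.ofReal t < maximal μ (A.indicator f) x + ENNReal.ofReal (t / 2) :=
        lt_of_lt_of_le hx (maximal_le_add h hle x)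
      rw [ht2] at h1
      exact lt_of_add_lt_add_right h1
    have hweak := h.weak_type_maximal (A.indicator f) (ENNReal.ofReal (t / 2))
    rw [lintegral_indicator hAm, ← withDensity_apply _ hAm] at hweak
    -- A factor `t / 2` is split off for the weak type bound. What remains is the layer cake weight
    -- of exponent `r - 1`, applied below to `2 f` and the measure `f dμ`.
    have e1 : ENNReal.ofReal (r * t ^ (r - 1)) =
        ENNReal.ofReal (2 * r / (r - 1)) * ENNReal.ofReal ((r - 1) * t ^ (r - 1 - 1)) *
          ENNReal.ofReal (t / 2) := by
      rw [← ENNReal.ofReal_mul (by positivity), ← ENNReal.ofReal_mul (by positivity)]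
      congr 1
      rw [Real.rpow_sub_one ht.ne' (r - 1)]
      field_simp
    calc _ ≤ ENNReal.ofReal (2 * r / (r - 1)) * ENNReal.ofReal ((r - 1) * t ^ (r - 1 - 1)) *
          (ENNReal.ofReal (t / 2) *
            μ {x | ENNReal.ofReal (t / 2) < maximal μ (A.indicator f) x}) := by
          rw [e1, mul_assoc]
          gcongr
      _ ≤ ENNReal.ofReal (2 * r / (r - 1)) * ENNReal.ofReal ((r - 1) * t ^ (r - 1 - 1)) *
          (D ^ 3 * μ.withDensity f A) := by gcongr
      _ = _ := by ring
  have hmax : Measurable (maximal μ f) := measurable_ballSup μ _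
  calc ∫⁻ x, maximal μ f x ^ r ∂μ
      = ∫⁻ t in Ioi (0 : ℝ), ENNReal.ofReal (r * t ^ (r - 1)) *
        μ {x | ENNReal.ofReal t < maximal μ f x} :=
        lintegral_rpow_eq_layercake μ hmax (by linarith)
    _ ≤ ∫⁻ t in Ioi (0 : ℝ), D ^ 3 * ENNReal.ofReal (2 * r / (r - 1)) *
        (ENNReal.ofReal ((r - 1) * t ^ (r - 1 - 1)) *
        μ.withDensity f {x | ENNReal.ofReal t < 2 * f x}) :=
        setLIntegral_mono' measurableSet_Ioi key
    _ = D ^ 3 * ENNReal.ofReal (2 * r / (r - 1)) *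
        ∫⁻ x, (2 * f x) ^ (r - 1) ∂(μ.withDensity f) := by
        rw [lintegral_const_mul' _ _ (ENNReal.mul_ne_top (h.pow_ne_top 3) ENNReal.ofReal_ne_top),
          lintegral_rpow_eq_layercake (μ.withDensity f) (by fun_prop) hr1]
    _ = D ^ 3 * ENNReal.ofReal (2 * r / (r - 1)) * (2 ^ (r - 1) * ∫⁻ x, f x ^ r ∂μ) := by
        rw [lintegral_withDensity_eq_lintegral_mul μ hf (by fun_prop),
          ← lintegral_const_mul' _ _ (ENNReal.rpow_ne_top_of_nonneg hr1.le (by simp))]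
        congr 1
        refine lintegral_congr fun x ↦ ?_
        rw [Pi.mul_apply, ENNReal.mul_rpow_of_nonneg _ _ hr1.le]
        have : f x ^ r = f x * f x ^ (r - 1) := by
          conv_lhs => rw [show r = 1 + (r - 1) by ring]
          rw [ENNReal.rpow_add_of_nonneg _ _ zero_le_one hr1.le, ENNReal.rpow_one]
        rw [this]
        ring
    _ = _ := by ring

/-- Hölder's inequality on each ball. It turns the weak type (1,1) bound into weak type (r,r). -/
theorem DoublingWith.maximal_rpow_le (h : DoublingWith μ D) {r : ℝ} (hr : 1 ≤ r)
    {f : M → ℝ≥0∞} (hf : Measurable f) (x : M) :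
    maximal μ f x ^ r ≤ maximal μ (fun y ↦ f y ^ r) x := by
  have hr0 : 0 < r := by linarith
  rw [← ENNReal.le_rpow_inv_iff hr0]
  refine iSup_le fun c ↦ iSup_le fun s ↦ iSup_le fun hx ↦ ?_
  have hs := pos_of_mem_ball hx
  have h0 := h.ne_zero c s hs
  have ht := h.finite c s
  rw [ENNReal.le_rpow_inv_iff hr0]
  refine le_trans ?_ (le_iSup₂_of_le c s (le_iSup_of_le hx le_rfl))
  have := eLpNorm'_le_eLpNorm'_mul_rpow_measure_univ (μ := μ.restrict (ball c s)) zero_lt_one hr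
    hf.aestronglyMeasurable
  simp only [eLpNorm', enorm_eq_self, ENNReal.rpow_one, div_one, Measure.restrict_apply_univ] at this
  calc ((∫⁻ y in ball c s, f y ∂μ) / μ (ball c s)) ^ r
      ≤ (((∫⁻ y in ball c s, f y ^ r ∂μ) ^ (1 / r) * μ (ball c s) ^ (1 - 1 / r)) /
          μ (ball c s)) ^ r := by gcongr
    _ = _ := by
      rw [ENNReal.div_rpow_of_nonneg _ _ hr0.le, ENNReal.mul_rpow_of_nonneg _ _ hr0.le,
        ← ENNReal.rpow_mul, ← ENNReal.rpow_mul, one_div_mul_cancel hr0.ne', ENNReal.rpow_one,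
        mul_div_assoc, ← ENNReal.rpow_sub _ _ h0 ht,
        show (1 - 1 / r) * r - r = -1 by field_simp; ring, ENNReal.rpow_neg_one, div_eq_mul_inv]

end Maximal

/-! ### Tents, and area and Carleson functions of measures on the half space. -/

section Tent

variable {M : Type*} [MetricSpace M] [MeasurableSpace M] {μ : Measure M} {D : ℝ≥0∞}

theorem mem_cone {x : M} {z : ℝ × M} : z ∈ cone x ↔ x ∈ ball z.2 z.1 := by
  constructor
  · exact fun h ↦ mem_ball_comm.1 h.2
  · exact fun h ↦ ⟨pos_of_mem_ball h, mem_ball_comm.1 h⟩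

theorem mem_tent {O : Set M} {z : ℝ × M} : z ∈ tent O ↔ 0 < z.1 ∧ ball z.2 z.1 ⊆ O := by
  simp only [tent, Set.mem_sdiff, mem_ofPred_eq, mem_iUnion, mem_cone, mem_compl_iff, exists_prop,
    not_exists, not_and, and_congr_right_iff]
  exact fun _ ↦ ⟨fun h x hx ↦ by_contra fun hO ↦ h x hO hx, fun h x hO hx ↦ hO (h hx)⟩

theorem tent_mono {O O' : Set M} (h : O ⊆ O') : tent O ⊆ tent O' := fun _ hz ↦
  mem_tent.2 ⟨(mem_tent.1 hz).1, (mem_tent.1 hz).2.trans h⟩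

theorem snd_mem_of_mem_tent {O : Set M} {z : ℝ × M} (hz : z ∈ tent O) : z.2 ∈ O :=
  (mem_tent.1 hz).2 (mem_ball_self (mem_tent.1 hz).1)

theorem isOpen_cone_graph : IsOpen {p : M × ℝ × M | p.2 ∈ cone p.1} := by
  simp only [mem_cone, mem_ball]
  exact isOpen_lt (by fun_prop) (by fun_prop)

variable [BorelSpace M] [SecondCountableTopology M]

theorem measurableSet_cone_graph : MeasurableSet {p : M × ℝ × M | p.2 ∈ cone p.1} :=
  isOpen_cone_graph.measurableSet

theorem measurableSet_cone (x : M) : MeasurableSet (cone x) :=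
  (isOpen_cone_graph.preimage (by fun_prop : Continuous fun z : ℝ × M ↦ (x, z))).measurableSet

theorem measurableSet_tent (O : Set M) : MeasurableSet (tent O) := by
  refine (measurableSet_lt measurable_const measurable_fst).diff (IsOpen.measurableSet ?_)
  exact isOpen_biUnion fun x _ ↦
    isOpen_cone_graph.preimage (by fun_prop : Continuous fun z : ℝ × M ↦ (x, z))

theorem measurable_measure_ball [SFinite μ] :
    Measurable fun p : M × ℝ ↦ μ (ball p.1 p.2) := by
  have : MeasurableSet {q : (M × ℝ) × M | dist q.2 q.1.1 < q.1.2} :=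
    (isOpen_lt (by fun_prop) (by fun_prop)).measurableSet
  exact measurable_measure_prodMk_left this

/-- The square of the area function of the measure `ν` on the upper half space. -/
noncomputable def sqArea (μ : Measure M) (ν : Measure (ℝ × M)) (x : M) : ℝ≥0∞ :=
  ∫⁻ z in cone x, (μ (ball x z.1))⁻¹ ∂ν

/-- The square of the Carleson function of the measure `ν` on the upper half space. -/
noncomputable def sqCarleson (μ : Measure M) (ν : Measure (ℝ × M)) : M → ℝ≥0∞ :=
  ballSup μ fun c r ↦ ν (tent (ball c r))

theorem measurable_sqArea_integrand [SFinite μ] :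
    Measurable fun p : M × ℝ × M ↦ {p : M × ℝ × M | p.2 ∈ cone p.1}.indicator
      (fun p ↦ (μ (ball p.1 p.2.1))⁻¹) p := by
  refine Measurable.indicator ?_ measurableSet_cone_graph
  exact (measurable_measure_ball.comp
    (by fun_prop : Measurable fun p : M × ℝ × M ↦ (p.1, p.2.1))).inv

theorem sqArea_eq_lintegral (ν : Measure (ℝ × M)) (x : M) :
    sqArea μ ν x = ∫⁻ z, {p : M × ℝ × M | p.2 ∈ cone p.1}.indicator
      (fun p ↦ (μ (ball p.1 p.2.1))⁻¹) (x, z) ∂ν := by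
  rw [sqArea, ← lintegral_indicator (measurableSet_cone x)]
  rfl

theorem measurable_sqArea [SFinite μ] (ν : Measure (ℝ × M)) [SFinite ν] :
    Measurable (sqArea μ ν) := by
  simp only [funext (sqArea_eq_lintegral (μ := μ) ν)]
  exact measurable_sqArea_integrand.lintegral_prod_right'

/-- Tonelli's theorem: `(t, y)` lies in the cone at `x` exactly when `x` lies in the ball of center
`y` and radius `t`. -/
theorem lintegral_sqArea_mul [SFinite μ] (ν : Measure (ℝ × M)) [SFinite ν] {f : M → ℝ≥0∞}
    (hf : Measurable f) :
    ∫⁻ x, sqArea μ ν x * f x ∂μ =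
      ∫⁻ z, ∫⁻ x in ball z.2 z.1, (μ (ball x z.1))⁻¹ * f x ∂μ ∂ν := by
  calc ∫⁻ x, sqArea μ ν x * f x ∂μ
      = ∫⁻ x, ∫⁻ z, {p : M × ℝ × M | p.2 ∈ cone p.1}.indicator
        (fun p ↦ (μ (ball p.1 p.2.1))⁻¹) (x, z) * f x ∂ν ∂μ := by
        refine lintegral_congr fun x ↦ ?_
        rw [lintegral_mul_const, sqArea_eq_lintegral]
        exact measurable_sqArea_integrand.comp (by fun_prop)
    _ = ∫⁻ z, ∫⁻ x, {p : M × ℝ × M | p.2 ∈ cone p.1}.indicator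
        (fun p ↦ (μ (ball p.1 p.2.1))⁻¹) (x, z) * f x ∂μ ∂ν := by
        refine lintegral_lintegral_swap (Measurable.aemeasurable ?_)
        exact measurable_sqArea_integrand.mul (hf.comp measurable_fst)
    _ = _ := by
        refine lintegral_congr fun z ↦ ?_
        rw [← lintegral_indicator measurableSet_ball]
        refine lintegral_congr fun x ↦ ?_
        by_cases hx : x ∈ ball z.2 z.1
        · have hx' : (x, z) ∈ {p : M × ℝ × M | p.2 ∈ cone p.1} := mem_cone.2 hx
          rw [indicator_of_mem hx, indicator_of_mem hx']
        · have hx' : (x, z) ∉ {p : M × ℝ × M | p.2 ∈ cone p.1} := fun h ↦ hx (mem_cone.1 h)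
          rw [indicator_of_notMem hx, indicator_of_notMem hx', zero_mul]

namespace DoublingWith

theorem inv_measure_ball_le (h : DoublingWith μ D) {x y : M} {t : ℝ} (hx : x ∈ ball y t) :
    (μ (ball x t))⁻¹ ≤ D * (μ (ball y t))⁻¹ := by
  have ht := pos_of_mem_ball hx
  have h1 : μ (ball y t) ≤ D * μ (ball x t) := by
    simpa using h.measure_ball_le ht 1 (by rw [mem_ball'] at hx; linarith)
  rw [← div_eq_mul_inv, ENNReal.le_div_iff_mul_le (Or.inl (h.ne_zero y t ht))
    (Or.inl (h.finite y t)), mul_comm, ← div_eq_mul_inv,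
    ENNReal.div_le_iff (h.ne_zero x t ht) (h.finite x t)]
  exact h1

/-- For `(t, y)` in the tent, the whole ball of center `y` and radius `t` lies in `O`, and by
doubling the integral of `1 / V(x, t)` over that ball is at least `1 / D`. Tonelli turns this into
the area function. -/
theorem measure_tent_le_lintegral_sqArea (h : DoublingWith μ D) (ν : Measure (ℝ × M)) [SFinite ν]
    (O : Set M) (hO : MeasurableSet O) :
    ν (tent O) ≤ D * ∫⁻ x in O, sqArea μ ν x ∂μ := by
  have := h.sigmaFinite
  have hD0 : D ≠ 0 := (zero_lt_one.trans_le h.one_le).ne'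
  calc ν (tent O) = ∫⁻ z in tent O, 1 ∂ν := by simp
    _ ≤ ∫⁻ z in tent O, D * ∫⁻ x in ball z.2 z.1, (μ (ball x z.1))⁻¹ * O.indicator 1 x ∂μ ∂ν := by
        refine setLIntegral_mono' (measurableSet_tent O) fun z hz ↦ ?_
        obtain ⟨hz0, hzO⟩ := mem_tent.1 hz
        calc (1 : ℝ≥0∞) = D * (D⁻¹ * (μ (ball z.2 z.1))⁻¹ * μ (ball z.2 z.1)) := by
              rw [mul_assoc, ENNReal.inv_mul_cancel (h.ne_zero _ _ hz0) (h.finite _ _), mul_one,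
                ENNReal.mul_inv_cancel hD0 h.ne_top]
          _ = D * ∫⁻ x in ball z.2 z.1, D⁻¹ * (μ (ball z.2 z.1))⁻¹ ∂μ := by
              rw [setLIntegral_const]
          _ ≤ _ := by
              refine mul_le_mul_right ?_ D
              refine setLIntegral_mono' (measurableSet_ball (x := z.2)) fun x hx ↦ ?_
              rw [indicator_of_mem (hzO hx), Pi.one_apply, mul_one,
                ← ENNReal.mul_inv (Or.inl hD0) (Or.inl h.ne_top), ENNReal.inv_le_inv]
              simpa using h.measure_ball_le hz0 1 (by rw [mem_ball] at hx; linarith)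
    _ ≤ ∫⁻ z, D * ∫⁻ x in ball z.2 z.1, (μ (ball x z.1))⁻¹ * O.indicator 1 x ∂μ ∂ν :=
        setLIntegral_le_lintegral _ _
    _ = D * ∫⁻ x, sqArea μ ν x * O.indicator 1 x ∂μ := by
        rw [lintegral_const_mul' _ _ h.ne_top, lintegral_sqArea_mul ν (measurable_one.indicator hO)]
    _ = _ := by
        rw [← lintegral_indicator hO]
        congr 2 with x
        by_cases hx : x ∈ O <;> simp [hx]

/-- A tent over a ball projects into the ball, so the projection of `ν` to `M` dominates the tent
masses. -/
theorem weak_type_sqCarleson (h : DoublingWith μ D) (ν : Measure (ℝ × M)) (s : ℝ≥0∞) :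
    s * μ {x | s < sqCarleson μ ν x} ≤ D ^ 3 * ν univ := by
  have := h.weak_type (φ := fun c r ↦ ν (tent (ball c r))) (ν := ν.map Prod.snd) (fun c r ↦ by
    rw [Measure.map_apply measurable_snd measurableSet_ball]
    exact measure_mono fun z hz ↦ snd_mem_of_mem_tent hz) s
  rwa [Measure.map_apply measurable_snd MeasurableSet.univ, preimage_univ] at this

theorem sqCarleson_le_maximal_sqArea (h : DoublingWith μ D) (ν : Measure (ℝ × M)) [SFinite ν]
    (x : M) : sqCarleson μ ν x ≤ D * maximal μ (sqArea μ ν) x := by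
  refine iSup_le fun c ↦ iSup_le fun r ↦ iSup_le fun hx ↦ ?_
  calc _ ≤ D * (∫⁻ y in ball c r, sqArea μ ν y ∂μ) / μ (ball c r) := by
        gcongr
        exact h.measure_tent_le_lintegral_sqArea ν _ measurableSet_ball
    _ = D * ((∫⁻ y in ball c r, sqArea μ ν y ∂μ) / μ (ball c r)) := mul_div_assoc _ _ _
    _ ≤ _ := by
        gcongr
        exact le_iSup₂_of_le c r (le_iSup_of_le hx le_rfl)

/-- The square of the Carleson function is at most `D` times the maximal function of the squared
area function; Hölder and weak type (1,1) for the power `P` do the rest. This is how an `L^P` bound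
on the area function of the outer part is used. -/
theorem weak_type_sqCarleson_rpow (h : DoublingWith μ D) (ν : Measure (ℝ × M)) [SFinite ν]
    {P : ℝ} (hP : 1 ≤ P) (s : ℝ≥0∞) :
    s ^ P * μ {x | s < sqCarleson μ ν x} ≤ D ^ P * D ^ 3 * ∫⁻ x, sqArea μ ν x ^ P ∂μ := by
  have := h.sigmaFinite
  have hP0 : 0 < P := by linarith
  have hD0 : D ≠ 0 := (zero_lt_one.trans_le h.one_le).ne'
  have hDP : D ^ P ≠ 0 := by simp [hD0, h.ne_top]
  have hDP' : D ^ P ≠ ⊤ := ENNReal.rpow_ne_top_of_nonneg hP0.le h.ne_top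
  have hsub : {x | s < sqCarleson μ ν x} ⊆
      {x | s ^ P / D ^ P < maximal μ (fun y ↦ sqArea μ ν y ^ P) x} := by
    intro x hx
    have h1 : s < D * maximal μ (sqArea μ ν) x :=
      lt_of_lt_of_le hx (h.sqCarleson_le_maximal_sqArea ν x)
    rw [← ENNReal.rpow_lt_rpow_iff hP0, ENNReal.mul_rpow_of_nonneg _ _ hP0.le, mul_comm] at h1
    exact lt_of_lt_of_le (ENNReal.div_lt_of_lt_mul h1)
      (h.maximal_rpow_le hP (measurable_sqArea ν) x)
  calc s ^ P * μ {x | s < sqCarleson μ ν x}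
      = D ^ P * (s ^ P / D ^ P * μ {x | s < sqCarleson μ ν x}) := by
        rw [← mul_assoc, ENNReal.mul_div_cancel hDP hDP']
    _ ≤ D ^ P * (s ^ P / D ^ P *
        μ {x | s ^ P / D ^ P < maximal μ (fun y ↦ sqArea μ ν y ^ P) x}) := by gcongr
    _ ≤ D ^ P * (D ^ 3 * ∫⁻ x, sqArea μ ν x ^ P ∂μ) := by
        exact mul_le_mul_right (h.weak_type_maximal _ _) _
    _ = _ := by ring

end DoublingWith

end Tent

/-! ### Carleson's inequality and the passage from area to Carleson functions. -/

section CarlesonEmbedding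

/-- Division by `I ^ (1 / Q')`, which is why `I` must be finite; this closes the duality argument.
-/
theorem le_rpow_of_le_mul_rpow {I A : ℝ≥0∞} {Q Q' : ℝ} (hQ : Q.HolderConjugate Q') (hI : I ≠ ⊤)
    (hle : I ≤ A * I ^ (1 / Q')) : I ≤ A ^ Q := by
  have hQ0 := hQ.pos
  rcases eq_or_ne I 0 with rfl | h0
  · simp
  have h1 : I ^ (1 / Q) ≤ A := by
    have e : I = I ^ (1 / Q) * I ^ (1 / Q') := by
      rw [← ENNReal.rpow_add _ _ h0 hI, one_div, one_div, hQ.inv_add_inv_eq_one, ENNReal.rpow_one]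
    have hne : I ^ (1 / Q') ≠ 0 := by simp [h0, hI]
    have hne' : I ^ (1 / Q') ≠ ⊤ :=
      ENNReal.rpow_ne_top_of_nonneg (one_div_nonneg.2 hQ.symm.nonneg) hI
    exact (ENNReal.mul_le_mul_iff_left hne hne').1 (e.symm.le.trans hle)
  calc I = (I ^ (1 / Q)) ^ Q := by
        rw [← ENNReal.rpow_mul, one_div_mul_cancel hQ0.ne', ENNReal.rpow_one]
    _ ≤ A ^ Q := by gcongr

variable {M : Type*} [MetricSpace M] [MeasurableSpace M] {μ : Measure M} {D : ℝ≥0∞}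
  [BorelSpace M] [SecondCountableTopology M]

namespace DoublingWith

/-- The enlarged ball competes in the supremum at every point of the small ball. Integrating over
the small ball and comparing the two volumes by doubling gives the bound. -/
theorem measure_tent_ball_le (h : DoublingWith μ D) (ν : Measure (ℝ × M)) (c : M) {s : ℝ}
    (hs : 0 < s) (k : ℕ) :
    ν (tent (ball c (2 ^ k * s))) ≤ D ^ k * ∫⁻ x in ball c s, sqCarleson μ ν x ∂μ := by
  have h0 := h.ne_zero c s hs
  have ht := h.finite c s
  rw [← ENNReal.mul_le_mul_iff_left h0 ht, ← setLIntegral_const]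
  have hss : s ≤ 2 ^ k * s := le_mul_of_one_le_left hs.le (one_le_pow₀ (by norm_num))
  calc ∫⁻ _ in ball c s, ν (tent (ball c (2 ^ k * s))) ∂μ
      ≤ ∫⁻ x in ball c s, D ^ k * μ (ball c s) * sqCarleson μ ν x ∂μ := by
        refine setLIntegral_mono' measurableSet_ball fun x hx ↦ ?_
        calc _ ≤ sqCarleson μ ν x * μ (ball c (2 ^ k * s)) :=
              h.le_ballSup_mul (fun c r ↦ ν (tent (ball c r))) (ball_subset_ball hss hx)
          _ ≤ sqCarleson μ ν x * (D ^ k * μ (ball c s)) := by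
              gcongr
              exact h.measure_ball_two_pow c hs k
          _ = _ := by ring
    _ = _ := by
        rw [lintegral_const_mul' _ _ (ENNReal.mul_ne_top (h.pow_ne_top k) ht)]
        ring

/-- The measure of the tent over an open set is controlled by the integral of the Carleson
function. -/
theorem measure_tent_le (h : DoublingWith μ D) (ν : Measure (ℝ × M)) {O : Set M}
    (hO : IsOpen O) : ν (tent O) ≤ D ^ 5 * ∫⁻ x in O, sqCarleson μ ν x ∂μ := by
  rcases isEmpty_or_nonempty M with hM | ⟨⟨x₀⟩⟩
  · simp [Set.eq_empty_of_isEmpty (tent O)]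
  rcases Oᶜ.eq_empty_or_nonempty with hc | hne
  -- Without a complement there is no Whitney covering; the space is exhausted by balls instead.
  · have hcov : tent O ⊆ ⋃ N : ℕ, tent (ball x₀ (N : ℝ)) := by
      intro z hz
      obtain ⟨N, hN⟩ := exists_nat_ge (z.1 + dist z.2 x₀)
      exact mem_iUnion.2 ⟨N, mem_tent.2 ⟨(mem_tent.1 hz).1, ball_subset_ball' hN⟩⟩
    have hmono : Monotone fun N : ℕ ↦ tent (ball x₀ (N : ℝ)) := fun N N' hN ↦
      tent_mono (ball_subset_ball (by exact_mod_cast hN))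
    refine (measure_mono hcov).trans ?_
    rw [hmono.measure_iUnion]
    refine iSup_le fun N ↦ ?_
    have hN : N ≤ N + 1 := N.le_succ
    refine (measure_mono (hmono hN)).trans ?_
    have := h.measure_tent_ball_le ν x₀ (s := (N + 1 : ℕ)) (by positivity) 0
    rw [pow_zero, one_mul, pow_zero, one_mul] at this
    refine this.trans ((lintegral_mono_set ?_).trans (le_mul_of_one_le_left' (h.one_le_pow 5)))
    rw [compl_empty_iff.1 hc]
    exact subset_univ _
  · set A : ℕ → Set (ℝ × M) := fun R ↦ {z ∈ tent O | infDist z.2 Oᶜ ≤ R} with hA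
    have hcov : tent O ⊆ ⋃ R, A R := by
      intro z hz
      obtain ⟨R, hR⟩ := exists_nat_ge (infDist z.2 Oᶜ)
      exact mem_iUnion.2 ⟨R, hz, hR⟩
    have hmono : Monotone A := fun R R' hR z hz ↦
      ⟨hz.1, hz.2.trans (by exact_mod_cast hR)⟩
    refine (measure_mono hcov).trans ?_
    rw [hmono.measure_iUnion]
    refine iSup_le fun R ↦ ?_
    obtain ⟨u, -, huc, hd, hpos, hsub, hw⟩ := exists_whitney_cover hO hne
      (A := {y ∈ O | infDist y Oᶜ ≤ R}) (fun y hy ↦ hy.1) R (fun y hy ↦ hy.2)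
    -- Let `δ` be the distance from `b` to the complement. The height is at most the distance from
    -- `z.2` to the complement, so at most `3δ/2`, and `z.2` is within `δ/2` of `b`. A ball of
    -- radius `2δ` therefore suffices, and `2 ^ 5 / 10 ≥ 2`.
    have hAR : A R ⊆ ⋃ b ∈ u, tent (ball b (2 ^ 5 * (infDist b Oᶜ / 10))) := by
      rintro z ⟨hz, hzR⟩
      obtain ⟨b, hb, hzb⟩ := hw z.2 ⟨snd_mem_of_mem_tent hz, hzR⟩
      refine mem_biUnion hb (mem_tent.2 ⟨(mem_tent.1 hz).1, ball_subset_ball' ?_⟩)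
      have h1 : z.1 ≤ infDist z.2 Oᶜ := by
        refine (le_infDist hne).2 fun e he ↦ ?_
        by_contra hlt
        exact he ((mem_tent.1 hz).2 (mem_ball'.2 (not_le.1 hlt)))
      have h2 : infDist z.2 Oᶜ ≤ infDist b Oᶜ + dist z.2 b := infDist_le_infDist_add_dist
      have := hpos b hb
      linarith
    calc ν (A R) ≤ ∑' b : u, ν (tent (ball b.1 (2 ^ 5 * (infDist b.1 Oᶜ / 10)))) :=
          (measure_mono hAR).trans (measure_biUnion_le ν huc _)
      _ ≤ ∑' b : u, D ^ 5 * ∫⁻ x in ball b.1 (infDist b.1 Oᶜ / 10), sqCarleson μ ν x ∂μ := by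
          refine ENNReal.tsum_le_tsum fun b ↦ h.measure_tent_ball_le ν _ ?_ 5
          have := hpos b b.2
          positivity
      _ = D ^ 5 * ∫⁻ x in ⋃ b ∈ u, ball b (infDist b Oᶜ / 10), sqCarleson μ ν x ∂μ := by
          rw [ENNReal.tsum_mul_left, lintegral_biUnion huc (fun _ _ ↦ measurableSet_ball) hd]
      _ ≤ _ := by
          gcongr
          exact iUnion₂_subset hsub

/-- Carleson's inequality. -/
theorem lintegral_sqArea_mul_le (h : DoublingWith μ D) (ν : Measure (ℝ × M)) [SFinite ν]
    {f : M → ℝ≥0∞} (hf : Measurable f) :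
    ∫⁻ x, sqArea μ ν x * f x ∂μ ≤ D ^ 6 * ∫⁻ x, sqCarleson μ ν x * maximal μ f x ∂μ := by
  have := h.sigmaFinite
  have hκ : Measurable (sqCarleson μ ν) := measurable_ballSup μ _
  have hm : Measurable (maximal μ f) := measurable_ballSup μ _
  set Φ : ℝ × M → ℝ≥0∞ := fun z ↦ (μ (ball z.2 z.1))⁻¹ * ∫⁻ x in ball z.2 z.1, f x ∂μ with hΦ
  have hΦm : Measurable Φ := by
    refine Measurable.mul (measurable_measure_ball.comp
      (by fun_prop : Measurable fun z : ℝ × M ↦ (z.2, z.1))).inv ?_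
    simp only [← lintegral_indicator measurableSet_ball]
    have hS : MeasurableSet {p : (ℝ × M) × M | dist p.2 p.1.2 < p.1.1} :=
      (isOpen_lt (by fun_prop) (by fun_prop)).measurableSet
    exact ((hf.comp measurable_snd).indicator hS).lintegral_prod_right'
  -- The key inclusion: if the mean of `f` over a ball exceeds `s`, so does the maximal function on
  -- the entire ball. The level sets of `Φ` thus lie in tents over open sets, to which
  -- `measure_tent_le` applies.
  have hsub : ∀ s, {z | s < Φ z} ⊆ tent {x | s < maximal μ f x} := by
    intro s z hz
    have hz : s < Φ z := hz
    have hz0 : 0 < z.1 := by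
      by_contra hn
      simp [hΦ, ball_eq_empty.2 (not_lt.1 hn)] at hz
    refine mem_tent.2 ⟨hz0, fun x hx ↦ ?_⟩
    refine hz.trans_le ?_
    rw [hΦ]
    dsimp only
    rw [mul_comm, ← div_eq_mul_inv]
    exact le_iSup₂_of_le z.2 z.1 (le_iSup_of_le hx le_rfl)
  calc ∫⁻ x, sqArea μ ν x * f x ∂μ
      = ∫⁻ z, ∫⁻ x in ball z.2 z.1, (μ (ball x z.1))⁻¹ * f x ∂μ ∂ν := lintegral_sqArea_mul ν hf
    _ ≤ ∫⁻ z, D * Φ z ^ (1 : ℝ) ∂ν := by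
        refine lintegral_mono fun z ↦ ?_
        rw [hΦ, ENNReal.rpow_one, ← mul_assoc]
        refine (setLIntegral_mono' measurableSet_ball fun x hx ↦
          mul_le_mul_left (h.inv_measure_ball_le hx) _).trans_eq ?_
        rw [lintegral_const_mul _ hf]
    _ = D * ∫⁻ t in Ioi (0 : ℝ), ENNReal.ofReal (1 * t ^ ((1 : ℝ) - 1)) *
          ν {z | ENNReal.ofReal t < Φ z} := by
        rw [lintegral_const_mul' _ _ h.ne_top, lintegral_rpow_eq_layercake ν hΦm one_pos]
    _ ≤ D * ∫⁻ t in Ioi (0 : ℝ), D ^ 5 * (ENNReal.ofReal (1 * t ^ ((1 : ℝ) - 1)) *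
          μ.withDensity (sqCarleson μ ν) {x | ENNReal.ofReal t < maximal μ f x}) := by
        refine mul_le_mul_right (lintegral_mono fun t ↦ ?_) D
        dsimp only
        rw [mul_left_comm]
        gcongr
        refine (measure_mono (hsub _)).trans ?_
        have hop : IsOpen {x | ENNReal.ofReal t < maximal μ f x} := isOpen_lt_ballSup μ _ _
        rw [withDensity_apply _ hop.measurableSet]
        exact h.measure_tent_le ν hop
    _ = D ^ 6 * ∫⁻ x, maximal μ f x ^ (1 : ℝ) ∂(μ.withDensity (sqCarleson μ ν)) := by
        rw [lintegral_rpow_eq_layercake _ hm one_pos,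
          lintegral_const_mul' _ _ (h.pow_ne_top 5), ← mul_assoc]
        ring
    _ = _ := by
        simp only [ENNReal.rpow_one]
        rw [lintegral_withDensity_eq_lintegral_mul μ hκ hm]
        rfl

/-- The `L^Q` norm of the square of the area function is controlled by that of the square of the
Carleson function. -/
theorem lintegral_sqArea_rpow_le (h : DoublingWith μ D) {Q : ℝ} (hQ : 1 < Q) :
    ∃ C : ℝ≥0∞, C ≠ ⊤ ∧ ∀ (ν : Measure (ℝ × M)) [SFinite ν],
      ∫⁻ x, sqArea μ ν x ^ Q ∂μ ≤ C * ∫⁻ x, sqCarleson μ ν x ^ Q ∂μ := by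
  have := h.sigmaFinite
  have hQ0 : 0 < Q := by linarith
  have hconj := Real.HolderConjugate.conjExponent hQ
  set Q' := Q.conjExponent with hQ'
  have hQ'0 : 0 < Q' := hconj.symm.pos
  obtain ⟨C, hC, hmax⟩ := h.lintegral_maximal_rpow_le hconj.symm.lt
  refine ⟨(D ^ 6 * C ^ (1 / Q')) ^ Q, ENNReal.rpow_ne_top_of_nonneg hQ0.le (ENNReal.mul_ne_top
    (h.pow_ne_top 6) (ENNReal.rpow_ne_top_of_nonneg (by positivity) hC)), fun ν _ ↦ ?_⟩
  rcases isEmpty_or_nonempty M with hM | ⟨⟨x₀⟩⟩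
  · simp [Measure.eq_zero_of_isEmpty μ]
  have hκ : Measurable (sqCarleson μ ν) := measurable_ballSup μ _
  have ha : Measurable (sqArea μ ν) := measurable_sqArea ν
  refine lintegral_rpow_le_of_truncated μ ha (B := fun N ↦ ball x₀ N)
    (fun _ ↦ measurableSet_ball) (fun x ↦ ?_) fun N ↦ ?_
  · obtain ⟨N, hN⟩ := exists_nat_gt (dist x x₀)
    filter_upwards [eventually_ge_atTop N] with n hn
    exact hN.trans_le (by exact_mod_cast hn)
  set g : M → ℝ≥0∞ := (ball x₀ (N : ℝ)).indicator fun x ↦ min (sqArea μ ν x) N with hg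
  have hgm : Measurable g := (ha.min measurable_const).indicator measurableSet_ball
  have hga : ∀ x, g x ≤ sqArea μ ν x := fun x ↦
    (indicator_le_self _ _ x).trans (min_le_left _ _)
  have hfin : ∫⁻ x, g x ^ Q ∂μ ≠ ⊤ := by
    have : ∫⁻ x, g x ^ Q ∂μ ≤ ∫⁻ x in ball x₀ (N : ℝ), (N : ℝ≥0∞) ^ Q ∂μ := by
      rw [← lintegral_indicator measurableSet_ball]
      refine lintegral_mono fun x ↦ ?_
      by_cases hx : x ∈ ball x₀ (N : ℝ)
      · simp only [hg, indicator_of_mem hx]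
        gcongr
        exact min_le_right _ _
      · simp [hg, indicator_of_notMem hx, hQ0]
    refine ne_top_of_le_ne_top ?_ this
    rw [setLIntegral_const]
    exact ENNReal.mul_ne_top (ENNReal.rpow_ne_top_of_nonneg hQ0.le (ENNReal.natCast_ne_top N))
      (h.finite _ _)
  have hexp : (Q - 1) * Q' = Q := hconj.sub_one_mul_conj
  -- Duality by hand: Carleson's inequality is tested on `g ^ (Q - 1)`, followed by Hölder and the
  -- maximal theorem in `L^{Q'}`. Since `(Q - 1) Q' = Q`, the integral of `g ^ Q` returns to the
  -- power `1 / Q'`.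
  have hle : ∫⁻ x, g x ^ Q ∂μ ≤ (D ^ 6 * C ^ (1 / Q') * (∫⁻ x, sqCarleson μ ν x ^ Q ∂μ) ^ (1 / Q)) *
      (∫⁻ x, g x ^ Q ∂μ) ^ (1 / Q') := by
    calc ∫⁻ x, g x ^ Q ∂μ ≤ ∫⁻ x, sqArea μ ν x * g x ^ (Q - 1) ∂μ := by
          refine lintegral_mono fun x ↦ ?_
          have : g x ^ Q = g x * g x ^ (Q - 1) := by
            conv_lhs => rw [show Q = 1 + (Q - 1) by ring]
            rw [ENNReal.rpow_add_of_nonneg _ _ zero_le_one (by linarith), ENNReal.rpow_one]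
          dsimp only
          rw [this]
          gcongr
          exact hga x
      _ ≤ D ^ 6 * ∫⁻ x, (sqCarleson μ ν * maximal μ fun y ↦ g y ^ (Q - 1)) x ∂μ :=
          h.lintegral_sqArea_mul_le ν (hgm.pow_const _)
      _ ≤ D ^ 6 * ((∫⁻ x, sqCarleson μ ν x ^ Q ∂μ) ^ (1 / Q) *
          (∫⁻ x, maximal μ (fun y ↦ g y ^ (Q - 1)) x ^ Q' ∂μ) ^ (1 / Q')) := by
          gcongr
          exact ENNReal.lintegral_mul_le_Lp_mul_Lq μ hconj hκ.aemeasurable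
            (measurable_ballSup μ _).aemeasurable
      _ ≤ D ^ 6 * ((∫⁻ x, sqCarleson μ ν x ^ Q ∂μ) ^ (1 / Q) *
          (C * ∫⁻ x, g x ^ Q ∂μ) ^ (1 / Q')) := by
          gcongr
          refine (hmax _ (hgm.pow_const _)).trans_eq ?_
          simp only [← ENNReal.rpow_mul, hexp]
      _ = _ := by
          rw [ENNReal.mul_rpow_of_nonneg _ _ (by positivity)]
          ring
  refine (le_rpow_of_le_mul_rpow hconj hfin hle).trans_eq ?_
  rw [ENNReal.mul_rpow_of_nonneg _ _ hQ0.le, ← ENNReal.rpow_mul _ (1 / Q) Q,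
    one_div_mul_cancel hQ0.ne', ENNReal.rpow_one]

end DoublingWith

end CarlesonEmbedding

/-! ### The good-λ inequality for the Carleson function. -/

section GoodLambda

variable {M : Type*} [MetricSpace M] [MeasurableSpace M] {μ : Measure M} {D : ℝ≥0∞}
  [BorelSpace M] [SecondCountableTopology M]

/-- On each ball, `ν` splits into a part controlled by the maximal function of `φ` and a part whose
area function is controlled in `L^P`. -/
def LocalSplitting (μ : Measure M) (ν : Measure (ℝ × M)) (φ : M → ℝ≥0∞) (C : ℝ≥0∞) (P : ℝ) : Prop :=
  ∀ (c : M) (r : ℝ), 0 < r → ∃ ν₁ ν₂ : Measure (ℝ × M), SFinite ν₁ ∧ SFinite ν₂ ∧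
    (∀ O ⊆ ball c r, ν (tent O) ≤ ν₁ (tent O) + ν₂ (tent O)) ∧
    (∀ y ∈ ball c r, ν₁ univ ≤ C * μ (ball c r) * maximal μ φ y) ∧
    ∀ y ∈ ball c r, ∀ y' ∈ ball c r, ∫⁻ x, sqArea μ ν₂ x ^ P ∂μ ≤
      C * μ (ball c r) * (sqCarleson μ ν y + maximal μ φ y') ^ P

namespace DoublingWith

/-- Averages over growing balls around `x` stay below the maximal function at `x`. Needed when a
superlevel set is the whole space. -/
theorem lintegral_le_maximal_mul (h : DoublingWith μ D) (φ : M → ℝ≥0∞) (x : M) :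
    ∫⁻ y, φ y ∂μ ≤ maximal μ φ x * μ univ := by
  have hmono : Monotone fun N : ℕ ↦ ball x ((N : ℝ) + 1) := fun N N' hN ↦
    ball_subset_ball (by gcongr)
  have hun : ⋃ N : ℕ, ball x ((N : ℝ) + 1) = univ := by
    refine eq_univ_of_forall fun y ↦ ?_
    obtain ⟨N, hN⟩ := exists_nat_ge (dist y x)
    exact mem_iUnion.2 ⟨N, by rw [mem_ball]; linarith⟩
  rw [← setLIntegral_univ, ← withDensity_apply _ MeasurableSet.univ, ← hun, hmono.measure_iUnion]
  refine iSup_le fun N ↦ ?_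
  rw [withDensity_apply _ measurableSet_ball]
  refine (h.le_ballSup_mul (fun c r ↦ ∫⁻ y in ball c r, φ y ∂μ)
    (mem_ball_self (by positivity : (0 : ℝ) < N + 1))).trans ?_
  exact mul_le_mul' le_rfl (measure_mono (subset_iUnion (fun N : ℕ ↦ ball x ((N : ℝ) + 1)) N))

/-- A large value of the Carleson function, at a point of a Whitney ball of its superlevel set,
comes from a tent over a ball contained in a multiple of the Whitney ball. -/
theorem exists_ball_of_lt_sqCarleson (h : DoublingWith μ D) {ν : Measure (ℝ × M)} {s K : ℝ≥0∞}
    (hK : D ^ 5 ≤ K) (hne : {x | s < sqCarleson μ ν x}ᶜ.Nonempty) {b x : M}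
    (hb : 0 < infDist b {x | s < sqCarleson μ ν x}ᶜ)
    (hxb : dist x b ≤ infDist b {x | s < sqCarleson μ ν x}ᶜ / 2) (hx : K * s < sqCarleson μ ν x) :
    ∃ c r, x ∈ ball c r ∧ ball c r ⊆ ball b (3 * infDist b {x | s < sqCarleson μ ν x}ᶜ) ∧
      K * s < ν (tent (ball c r)) / μ (ball c r) := by
  set δ := infDist b {x | s < sqCarleson μ ν x}ᶜ with hδ
  obtain ⟨c, r, hxc, hlt⟩ := lt_ballSup_iff.1 hx
  have hr := pos_of_mem_ball hxc
  rw [mem_ball] at hxc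
  refine ⟨c, r, hxc, ball_subset_ball' ?_, hlt⟩
  have hcb : dist c b ≤ dist x c + dist x b := dist_triangle_left _ _ _
  suffices r ≤ δ / 8 by linarith
  -- If `r > δ / 8`, the ball of radius `2 ^ 5 * r` about `c` reaches a point `e` outside the
  -- superlevel set (`2δ + δ/2 + r < 21 r`). There the Carleson function is at most `s`, and
  -- doubling contradicts the choice `K ≥ D ^ 5`.
  by_contra hr8
  push Not at hr8
  obtain ⟨e, he, hbe⟩ := (infDist_lt_iff (r := 2 * δ) hne).1 (by linarith)
  have hec : e ∈ ball c (2 ^ 5 * r) := by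
    have h1 : dist e c ≤ dist b e + dist c b := by
      rw [dist_comm b e, dist_comm c b]
      exact dist_triangle _ _ _
    rw [mem_ball]
    linarith
  have he' : sqCarleson μ ν e ≤ s := not_lt.1 he
  rw [h.lt_div_iff hr] at hlt
  refine absurd hlt (not_lt.2 ?_)
  calc ν (tent (ball c r)) ≤ ν (tent (ball c (2 ^ 5 * r))) :=
        measure_mono (tent_mono (ball_subset_ball (by linarith)))
    _ ≤ sqCarleson μ ν e * μ (ball c (2 ^ 5 * r)) :=
        h.le_ballSup_mul (fun c r ↦ ν (tent (ball c r))) hec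
    _ ≤ s * (D ^ 5 * μ (ball c r)) := by
        gcongr
        exact h.measure_ball_two_pow c hr 5
    _ ≤ s * (K * μ (ball c r)) := by gcongr
    _ = _ := by ring

/-- The splitting is applied on the ball of radius `3δ` about `b`. It contains a point off the
superlevel set, where `sqCarleson` is at most `s`, and the center `b`, where the maximal function is
at most `γ * s`. Weak type (1,1) for `ν₁` yields the term `γ`, weak type (P,P) for `ν₂` yields `K ^
(-P)`. -/
theorem measure_whitney_le (h : DoublingWith μ D) {ν : Measure (ℝ × M)} {φ : M → ℝ≥0∞}
    {C₁ : ℝ≥0∞} {P : ℝ} (hP : 1 ≤ P) (hloc : LocalSplitting μ ν φ C₁ P)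
    {s K γ : ℝ≥0∞} (hs : s ≠ 0) (hs' : s ≠ ⊤) (hK : D ^ 5 ≤ K) (hK' : K ≠ ⊤) (hγ : γ ≤ 1)
    (hne : {x | s < sqCarleson μ ν x}ᶜ.Nonempty) {b : M}
    (hb : 0 < infDist b {x | s < sqCarleson μ ν x}ᶜ) (hbγ : maximal μ φ b ≤ γ * s) :
    μ {x | dist x b ≤ infDist b {x | s < sqCarleson μ ν x}ᶜ / 2 ∧ K * s < sqCarleson μ ν x} ≤
      2 * D ^ P * D ^ 8 * C₁ * 4 ^ P * (γ + K ^ (-P)) *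
        μ (ball b (infDist b {x | s < sqCarleson μ ν x}ᶜ / 10)) := by
  set δ := infDist b {x | s < sqCarleson μ ν x}ᶜ with hδ
  have hP0 : 0 < P := by linarith
  have hK1 : 1 ≤ K := (h.one_le_pow 5).trans hK
  have hK0 : K ≠ 0 := (zero_lt_one.trans_le hK1).ne'
  obtain ⟨ν₁, ν₂, _, _, hsplit, h1, h2⟩ := hloc b (3 * δ) (by positivity)
  set V := μ (ball b (δ / 10)) with hV
  have hball : μ (ball b (3 * δ)) ≤ D ^ 5 * V := h.measure_ball_le (by positivity) 5 (by
    rw [dist_self]; linarith)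
  have hbb : b ∈ ball b (3 * δ) := mem_ball_self (by positivity)
  obtain ⟨e, he, hbe⟩ := (infDist_lt_iff (r := 3 * δ) hne).1 (by linarith)
  have he' : sqCarleson μ ν e ≤ s := not_lt.1 he
  have heb : e ∈ ball b (3 * δ) := mem_ball'.2 hbe
  -- One of the two pieces must account for half of the height `K * s`.
  set σ := K * s / 2 with hσ
  have hσ0 : σ ≠ 0 := by simp [hσ, hK0, hs]
  have hσt : σ ≠ ⊤ := ENNReal.div_ne_top (ENNReal.mul_ne_top hK' hs') (by simp)
  have hsub : {x | dist x b ≤ δ / 2 ∧ K * s < sqCarleson μ ν x} ⊆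
      {x | σ < sqCarleson μ ν₁ x} ∪ {x | σ < sqCarleson μ ν₂ x} := by
    rintro x ⟨hxb, hx⟩
    obtain ⟨c, r, hxc, hcr, hlt⟩ := h.exists_ball_of_lt_sqCarleson hK hne hb hxb hx
    by_contra hcon
    simp only [mem_union, mem_ofPred_eq, not_or, not_lt] at hcon
    refine absurd hlt (not_lt.2 ?_)
    calc _ ≤ (ν₁ (tent (ball c r)) + ν₂ (tent (ball c r))) / μ (ball c r) := by
          gcongr
          exact hsplit _ hcr
      _ = ν₁ (tent (ball c r)) / μ (ball c r) + ν₂ (tent (ball c r)) / μ (ball c r) :=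
          ENNReal.add_div
      _ ≤ σ + σ := add_le_add
          (le_trans (le_ballSup (fun c r ↦ ν₁ (tent (ball c r))) hxc) hcon.1)
          (le_trans (le_ballSup (fun c r ↦ ν₂ (tent (ball c r))) hxc) hcon.2)
      _ = K * s := ENNReal.add_halves _
  have m1 : μ {x | σ < sqCarleson μ ν₁ x} ≤ 2 * D ^ 8 * C₁ * γ * V := by
    rw [← ENNReal.mul_le_mul_iff_right hσ0 hσt]
    calc _ ≤ D ^ 3 * ν₁ univ := h.weak_type_sqCarleson ν₁ σ
      _ ≤ D ^ 3 * (C₁ * (D ^ 5 * V) * (γ * s)) := by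
          gcongr
          exact (h1 b hbb).trans (by gcongr)
      _ = D ^ 8 * C₁ * V * γ * (1 * s) := by ring
      _ ≤ D ^ 8 * C₁ * V * γ * (K * s) := by gcongr
      _ = D ^ 8 * C₁ * V * γ * (σ + σ) := by rw [hσ, ENNReal.add_halves]
      _ = _ := by ring
  have hσP0 : σ ^ P ≠ 0 := by simp [hσ0, hσt]
  have hσPt : σ ^ P ≠ ⊤ := ENNReal.rpow_ne_top_of_nonneg hP0.le hσt
  have m2 : μ {x | σ < sqCarleson μ ν₂ x} ≤ D ^ P * D ^ 8 * C₁ * 4 ^ P * K ^ (-P) * V := by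
    rw [← ENNReal.mul_le_mul_iff_right hσP0 hσPt]
    have e1 : s + γ * s ≤ 4 * K⁻¹ * σ := by
      calc s + γ * s ≤ s + 1 * s := by gcongr
        _ = 2 * (K⁻¹ * K) * s := by rw [ENNReal.inv_mul_cancel hK0 hK']; ring
        _ = 2 * K⁻¹ * (K * s) := by ring
        _ = 2 * K⁻¹ * (σ + σ) := by rw [hσ, ENNReal.add_halves]
        _ = _ := by ring
    calc _ ≤ D ^ P * D ^ 3 * ∫⁻ x, sqArea μ ν₂ x ^ P ∂μ := h.weak_type_sqCarleson_rpow ν₂ hP σ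
      _ ≤ D ^ P * D ^ 3 * (C₁ * (D ^ 5 * V) * (s + γ * s) ^ P) := by
          gcongr
          exact (h2 e heb b hbb).trans (by gcongr)
      _ ≤ D ^ P * D ^ 3 * (C₁ * (D ^ 5 * V) * (4 * K⁻¹ * σ) ^ P) := by gcongr
      _ = _ := by
          rw [ENNReal.mul_rpow_of_nonneg _ _ hP0.le, ENNReal.mul_rpow_of_nonneg _ _ hP0.le,
            ENNReal.inv_rpow, ← ENNReal.rpow_neg]
          ring
  have hDP : 1 ≤ D ^ P := ENNReal.one_le_rpow h.one_le hP0
  have h4P : (1 : ℝ≥0∞) ≤ 4 ^ P := ENNReal.one_le_rpow (by norm_num) hP0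
  calc _ ≤ μ {x | σ < sqCarleson μ ν₁ x} + μ {x | σ < sqCarleson μ ν₂ x} :=
        (measure_mono hsub).trans (measure_union_le _ _)
    _ ≤ 2 * 1 * D ^ 8 * C₁ * 1 * γ * V + 1 * D ^ P * D ^ 8 * C₁ * 4 ^ P * K ^ (-P) * V := by
        rw [mul_one, mul_one, one_mul]
        exact add_le_add m1 m2
    _ ≤ 2 * D ^ P * D ^ 8 * C₁ * 4 ^ P * γ * V +
        2 * D ^ P * D ^ 8 * C₁ * 4 ^ P * K ^ (-P) * V := by
        gcongr
        norm_num
    _ = _ := by ring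

/-- The good-`λ` inequality. -/
theorem good_lambda (h : DoublingWith μ D) {ν : Measure (ℝ × M)} {φ : M → ℝ≥0∞}
    {C₀ C₁ : ℝ≥0∞} {P : ℝ} (hP : 1 ≤ P) (hloc : LocalSplitting μ ν φ C₁ P)
    (hν : ν univ ≤ C₀ * ∫⁻ x, φ x ∂μ) (hν' : ν univ ≠ ⊤)
    {s K γ : ℝ≥0∞} (hs : s ≠ 0) (hs' : s ≠ ⊤) (hK : D ^ 5 ≤ K) (hK' : K ≠ ⊤) (hγ : γ ≤ 1)
    (hγ' : D ^ 3 * C₀ * γ < 1) :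
    μ {x | K * s < sqCarleson μ ν x ∧ maximal μ φ x ≤ γ * s} ≤
      2 * D ^ P * D ^ 8 * C₁ * 4 ^ P * (γ + K ^ (-P)) * μ {x | s < sqCarleson μ ν x} := by
  set O : Set M := {x | s < sqCarleson μ ν x} with hO
  have hOo : IsOpen O := isOpen_lt_ballSup μ _ s
  set S : Set M := {x | K * s < sqCarleson μ ν x ∧ maximal μ φ x ≤ γ * s} with hS
  have hK1 : 1 ≤ K := (h.one_le_pow 5).trans hK
  have hSO : S ⊆ O := fun x hx ↦ (le_mul_of_one_le_left' hK1).trans_lt hx.1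
  rcases Oᶜ.eq_empty_or_nonempty with hc | hne
  -- If the superlevel set is everything, weak type makes `s * μ univ` finite. A point of `S` would
  -- give `∫ φ ≤ γ * s * μ univ`, and then `s * μ univ` would be smaller than itself because `D ^ 3
  -- * C₀ * γ < 1`.
  · suffices S = ∅ by simp [this]
    refine eq_empty_of_forall_notMem fun x hx ↦ ?_
    have hweak := h.weak_type_sqCarleson ν s
    rw [← hO, compl_empty_iff.1 hc] at hweak
    have h0 : μ univ ≠ 0 := fun h0 ↦ h.ne_zero x 1 one_pos (measure_mono_null (subset_univ _) h0)
    have hsμ : s * μ univ ≠ ⊤ :=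
      ne_top_of_le_ne_top (ENNReal.mul_ne_top (h.pow_ne_top 3) hν') hweak
    have h1 : s * μ univ ≤ D ^ 3 * C₀ * γ * (s * μ univ) := by
      calc s * μ univ ≤ D ^ 3 * ν univ := hweak
        _ ≤ D ^ 3 * (C₀ * (γ * s * μ univ)) := by
            gcongr
            refine hν.trans ?_
            gcongr
            exact (h.lintegral_le_maximal_mul φ x).trans (by gcongr; exact hx.2)
        _ = _ := by ring
    have h2 : D ^ 3 * C₀ * γ * (s * μ univ) < 1 * (s * μ univ) :=
      (ENNReal.mul_lt_mul_iff_left (mul_ne_zero hs h0) hsμ).2 hγ'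
    rw [one_mul] at h2
    exact absurd h1 (not_le.2 h2)
  · set A : ℕ → Set M := fun R ↦ {x ∈ S | infDist x Oᶜ ≤ R} with hA
    have hcov : S ⊆ ⋃ R, A R := by
      intro z hz
      obtain ⟨R, hR⟩ := exists_nat_ge (infDist z Oᶜ)
      exact mem_iUnion.2 ⟨R, hz, hR⟩
    have hmono : Monotone A := fun R R' hR z hz ↦
      ⟨hz.1, hz.2.trans (by exact_mod_cast hR)⟩
    refine (measure_mono hcov).trans ?_
    rw [hmono.measure_iUnion]
    refine iSup_le fun R ↦ ?_
    -- The centers are chosen in `A R`, hence in `S`, so the bound on the maximal function holds at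
    -- each of them.
    obtain ⟨u, huA, huc, hd, hpos, hsub, hw⟩ := exists_whitney_cover hOo hne
      (A := A R) (fun y hy ↦ hSO hy.1) R (fun y hy ↦ hy.2)
    have hAR : A R ⊆ ⋃ b ∈ u, {x | dist x b ≤ infDist b Oᶜ / 2 ∧ K * s < sqCarleson μ ν x} := by
      intro x hx
      obtain ⟨b, hb, hxb⟩ := hw x hx
      exact mem_biUnion hb ⟨hxb, hx.1.1⟩
    calc μ (A R) ≤ ∑' b : u, μ {x | dist x b ≤ infDist b.1 Oᶜ / 2 ∧ K * s < sqCarleson μ ν x} :=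
          (measure_mono hAR).trans (measure_biUnion_le μ huc _)
      _ ≤ ∑' b : u, 2 * D ^ P * D ^ 8 * C₁ * 4 ^ P * (γ + K ^ (-P)) *
            μ (ball b.1 (infDist b.1 Oᶜ / 10)) :=
          ENNReal.tsum_le_tsum fun b ↦ h.measure_whitney_le hP hloc hs hs' hK hK' hγ hne
            (hpos b b.2) (huA b.2).1.2
      _ = 2 * D ^ P * D ^ 8 * C₁ * 4 ^ P * (γ + K ^ (-P)) *
            μ (⋃ b ∈ u, ball b (infDist b Oᶜ / 10)) := by
          rw [ENNReal.tsum_mul_left, measure_biUnion huc hd fun _ _ ↦ measurableSet_ball]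
      _ ≤ _ := by
          gcongr
          exact iUnion₂_subset hsub

/-- Weak type (1,1) bounds the distribution function by a multiple of `1 / t`, and `t ^ (Q - 2)` is
integrable on `(0, N)` since `Q > 1`. This finiteness is what permits absorption. -/
theorem lintegral_min_sqCarleson_ne_top (h : DoublingWith μ D) {ν : Measure (ℝ × M)}
    (hν : ν univ ≠ ⊤) {Q : ℝ} (hQ : 1 < Q) (N : ℕ) :
    ∫⁻ x, min (sqCarleson μ ν x) N ^ Q ∂μ ≠ ⊤ := by
  have := h.sigmaFinite
  have hκ : Measurable (sqCarleson μ ν) := measurable_ballSup μ _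
  have hQ1 : 0 < Q - 1 := by linarith
  have hQ0 : 0 < Q := by linarith
  rw [lintegral_rpow_eq_layercake μ (hκ.min measurable_const) hQ0]
  have hfin : D ^ 3 * ν univ * ENNReal.ofReal (Q / (Q - 1)) * (N : ℝ≥0∞) ^ (Q - 1) ≠ ⊤ :=
    ENNReal.mul_ne_top (ENNReal.mul_ne_top (ENNReal.mul_ne_top (h.pow_ne_top 3) hν)
      ENNReal.ofReal_ne_top) (ENNReal.rpow_ne_top_of_nonneg hQ1.le (ENNReal.natCast_ne_top N))
  refine ne_top_of_le_ne_top hfin ?_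
  rw [rpow_eq_lintegral hQ1, ← lintegral_const_mul']
  · refine setLIntegral_mono' measurableSet_Ioi fun t ht ↦ ?_
    have ht : 0 < t := ht
    by_cases htN : ENNReal.ofReal t < N
    · have htm : t ∈ {t : ℝ | ENNReal.ofReal t < N} := htN
      rw [indicator_of_mem htm]
      have e1 : ENNReal.ofReal (Q * t ^ (Q - 1)) =
          ENNReal.ofReal (Q / (Q - 1)) * ENNReal.ofReal ((Q - 1) * t ^ (Q - 1 - 1)) *
            ENNReal.ofReal t := by
        rw [← ENNReal.ofReal_mul (by positivity), ← ENNReal.ofReal_mul (by positivity)]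
        congr 1
        rw [Real.rpow_sub_one ht.ne' (Q - 1)]
        field_simp
      calc _ ≤ ENNReal.ofReal (Q / (Q - 1)) * ENNReal.ofReal ((Q - 1) * t ^ (Q - 1 - 1)) *
            (ENNReal.ofReal t * μ {x | ENNReal.ofReal t < sqCarleson μ ν x}) := by
            rw [e1, mul_assoc]
            gcongr with x
            exact min_le_left _ _
        _ ≤ ENNReal.ofReal (Q / (Q - 1)) * ENNReal.ofReal ((Q - 1) * t ^ (Q - 1 - 1)) *
            (D ^ 3 * ν univ) := by
            exact mul_le_mul_right (h.weak_type_sqCarleson ν _) _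
        _ = _ := by ring
    · have : {x | ENNReal.ofReal t < min (sqCarleson μ ν x) N} = ∅ :=
        eq_empty_of_forall_notMem fun x hx ↦ htN (lt_of_lt_of_le hx (min_le_right _ _))
      rw [this, measure_empty, mul_zero]
      exact zero_le
  · exact ENNReal.mul_ne_top (ENNReal.mul_ne_top (h.pow_ne_top 3) hν) ENNReal.ofReal_ne_top

/-- First `K` is taken large, which works because `K ^ (Q - P)` tends to zero; then `γ` is taken
small depending on `K`. -/
theorem exists_good_lambda_constants {A B D : ℝ≥0∞} (hA : A ≠ ⊤) (hB : B ≠ ⊤) (hD : D ≠ ⊤)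
    (hD1 : 1 ≤ D) {P Q : ℝ} (hQ : 0 < Q) (hPQ : Q < P) :
    ∃ K γ : ℝ≥0∞, D ≤ K ∧ K ≠ ⊤ ∧ γ ≠ 0 ∧ γ ≤ 1 ∧ B * γ < 1 ∧
      K ^ Q * (A * (γ + K ^ (-P))) ≤ 2⁻¹ := by
  obtain ⟨K, hDK, hK, hAK⟩ : ∃ K : ℝ≥0∞, D ≤ K ∧ K ≠ ⊤ ∧ K ^ Q * (A * K ^ (-P)) ≤ 4⁻¹ := by
    have hlim : Tendsto (fun n : ℕ ↦ A * ((n : ℝ≥0∞) ^ (P - Q))⁻¹) atTop (𝓝 (A * (⊤ : ℝ≥0∞)⁻¹)) := by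
      refine ENNReal.Tendsto.const_mul (tendsto_inv_iff.2 ?_) (Or.inr hA)
      have := (ENNReal.continuous_rpow_const (y := P - Q)).tendsto ⊤
      rw [ENNReal.top_rpow_of_pos (by linarith)] at this
      exact this.comp ENNReal.tendsto_nat_nhds_top
    rw [ENNReal.inv_top, mul_zero] at hlim
    have h4 : (0 : ℝ≥0∞) < 4⁻¹ := ENNReal.inv_pos.2 (by simp)
    obtain ⟨n, hn1, hn2⟩ := ((hlim.eventually (ge_mem_nhds h4)).and
      (ENNReal.tendsto_nat_nhds_top.eventually (lt_mem_nhds hD.lt_top))).exists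
    refine ⟨n, hn2.le, ENNReal.natCast_ne_top n, ?_⟩
    have hn0 : (n : ℝ≥0∞) ≠ 0 := ((zero_lt_one.trans_le hD1).trans hn2).ne'
    refine le_trans (le_of_eq ?_) hn1
    rw [mul_left_comm, ← ENNReal.rpow_add _ _ hn0 (ENNReal.natCast_ne_top n), ← ENNReal.rpow_neg]
    congr 2
    ring
  -- `γ` will be `X⁻¹`: the summands ensure `γ ≤ 1`, `B * γ < 1` and `K ^ Q * A * γ ≤ 1 / 4`, in
  -- this order.
  set X := 1 + 2 * B + 4 * (K ^ Q * A) with hX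
  have hKA : K ^ Q * A ≠ ⊤ := ENNReal.mul_ne_top (ENNReal.rpow_ne_top_of_nonneg hQ.le hK) hA
  have hXt : X ≠ ⊤ := by
    simp only [hX, ne_eq, ENNReal.add_eq_top, ENNReal.one_ne_top, false_or, not_or]
    exact ⟨ENNReal.mul_ne_top (by simp) hB, ENNReal.mul_ne_top (by simp) hKA⟩
  have hX0 : X ≠ 0 := by simp [hX]
  have hX1 : 1 ≤ X := by rw [hX, add_assoc]; exact le_self_add
  refine ⟨K, X⁻¹, hDK, hK, ENNReal.inv_ne_zero.2 hXt, ENNReal.inv_le_one.2 hX1, ?_, ?_⟩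
  · rw [← div_eq_mul_inv]
    refine (ENNReal.div_lt_iff (Or.inl hX0) (Or.inl hXt)).2 ?_
    rw [one_mul]
    calc B < 1 + B := by
          rw [add_comm]; exact ENNReal.lt_add_right hB one_ne_zero
      _ ≤ 1 + (B + B) + 4 * (K ^ Q * A) := by
          rw [← add_assoc, add_assoc (1 + B)]; exact le_self_add
      _ = X := by rw [hX, two_mul]
  · have h1 : K ^ Q * A * X⁻¹ ≤ 4⁻¹ := by
      rw [← div_eq_mul_inv]
      refine (ENNReal.div_le_iff hX0 hXt).2 ?_
      calc K ^ Q * A = 4⁻¹ * (4 * (K ^ Q * A)) := by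
            rw [← mul_assoc, ENNReal.inv_mul_cancel (by simp) (by simp), one_mul]
        _ ≤ 4⁻¹ * X := by
            gcongr
            exact le_add_self
    calc K ^ Q * (A * (X⁻¹ + K ^ (-P))) = K ^ Q * A * X⁻¹ + K ^ Q * (A * K ^ (-P)) := by ring
      _ ≤ 4⁻¹ + 4⁻¹ := add_le_add h1 hAK
      _ = 2⁻¹ := by
        rw [show (4 : ℝ≥0∞) = 2 * 2 by norm_num,
          ENNReal.mul_inv (Or.inl (by simp)) (Or.inl (by simp)), ← mul_add,
          ENNReal.inv_two_add_inv_two, mul_one]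

/-- The `L^Q` estimate for the Carleson function that results from the good-`λ` inequality. -/
theorem lintegral_sqCarleson_rpow_le (h : DoublingWith μ D) {C₀ C₁ : ℝ≥0∞} (hC₀ : C₀ ≠ ⊤)
    (hC₁ : C₁ ≠ ⊤) {P Q : ℝ} (hQ : 1 < Q) (hQP : Q < P) :
    ∃ C : ℝ≥0∞, C ≠ ⊤ ∧ ∀ (ν : Measure (ℝ × M)) (φ : M → ℝ≥0∞), Measurable φ →
      ∫⁻ x, φ x ∂μ ≠ ⊤ → ν univ ≤ C₀ * ∫⁻ x, φ x ∂μ → LocalSplitting μ ν φ C₁ P →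
      ∫⁻ x, sqCarleson μ ν x ^ Q ∂μ ≤ C * ∫⁻ x, φ x ^ Q ∂μ := by
  have := h.sigmaFinite
  have hQ0 : 0 < Q := by linarith
  have hP0 : 0 < P := by linarith
  set A := 2 * D ^ P * D ^ 8 * C₁ * 4 ^ P with hA
  have hAt : A ≠ ⊤ := by
    refine ENNReal.mul_ne_top (ENNReal.mul_ne_top (ENNReal.mul_ne_top (ENNReal.mul_ne_top
      (by simp) ?_) (h.pow_ne_top 8)) hC₁) ?_
    · exact ENNReal.rpow_ne_top_of_nonneg hP0.le h.ne_top
    · exact ENNReal.rpow_ne_top_of_nonneg hP0.le (by simp)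
  obtain ⟨K, γ, hK, hK', hγ0, hγ1, hγ, hKγ⟩ := exists_good_lambda_constants hAt
    (ENNReal.mul_ne_top (h.pow_ne_top 3) hC₀) (h.pow_ne_top 5) (h.one_le_pow 5) hQ0 hQP
  have hγt : γ ≠ ⊤ := ne_top_of_le_ne_top ENNReal.one_ne_top hγ1
  have hK1 : 1 ≤ K := (h.one_le_pow 5).trans hK
  have hK0 : K ≠ 0 := (zero_lt_one.trans_le hK1).ne'
  have hKQt : K ^ Q ≠ ⊤ := ENNReal.rpow_ne_top_of_nonneg hQ0.le hK'
  have hKQ0 : K ^ Q ≠ 0 := by simp [hK0, hK']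
  obtain ⟨C, hC, hmax⟩ := h.lintegral_maximal_rpow_le hQ
  refine ⟨2 * (K ^ Q * (γ⁻¹ ^ Q * C)), ?_, fun ν φ hφ hφt hν hloc ↦ ?_⟩
  · exact ENNReal.mul_ne_top (by simp) (ENNReal.mul_ne_top hKQt (ENNReal.mul_ne_top
      (ENNReal.rpow_ne_top_of_nonneg hQ0.le (ENNReal.inv_ne_top.2 hγ0)) hC))
  have hν' : ν univ ≠ ⊤ := ne_top_of_le_ne_top (ENNReal.mul_ne_top hC₀ hφt) hν
  have hκ : Measurable (sqCarleson μ ν) := measurable_ballSup μ _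
  have hm : Measurable (maximal μ φ) := measurable_ballSup μ _
  refine lintegral_rpow_le_of_truncated μ hκ (B := fun _ ↦ univ) (fun _ ↦ MeasurableSet.univ)
    (fun x ↦ Eventually.of_forall fun _ ↦ mem_univ x) fun N ↦ ?_
  simp only [indicator_univ]
  set ε := A * (γ + K ^ (-P)) with hε
  have hεt : ε ≠ ⊤ := by
    intro htop
    rw [htop, ENNReal.mul_top hKQ0] at hKγ
    simp at hKγ
  set I := ∫⁻ x, min (sqCarleson μ ν x) N ^ Q ∂μ with hI
  have hIt : I ≠ ⊤ := h.lintegral_min_sqCarleson_ne_top hν' hQ N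
  have hgm : Measurable fun x ↦ min (sqCarleson μ ν x) (N : ℝ≥0∞) := hκ.min measurable_const
  have hmeas : Measurable fun t : ℝ ↦ μ {x | ENNReal.ofReal t < min (sqCarleson μ ν x) N} :=
    Antitone.measurable fun a b hab ↦ measure_mono fun x hx ↦
      (ENNReal.ofReal_le_ofReal hab).trans_lt hx
  have hmeas' : Measurable fun t : ℝ ↦ ε * (ENNReal.ofReal (Q * t ^ (Q - 1)) *
      μ {x | ENNReal.ofReal t < min (sqCarleson μ ν x) N}) :=
    ((by fun_prop : Measurable fun t : ℝ ↦ ENNReal.ofReal (Q * t ^ (Q - 1))).mul hmeas).const_mul ε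
  have hmain : ∫⁻ x, (K⁻¹ * min (sqCarleson μ ν x) N) ^ Q ∂μ ≤
      ε * I + ∫⁻ x, (γ⁻¹ * maximal μ φ x) ^ Q ∂μ := by
    rw [hI, lintegral_rpow_eq_layercake μ (by fun_prop) hQ0,
      lintegral_rpow_eq_layercake μ hgm hQ0, lintegral_rpow_eq_layercake μ (by fun_prop) hQ0,
      ← lintegral_const_mul' _ _ hεt, ← lintegral_add_left hmeas']
    refine setLIntegral_mono' measurableSet_Ioi fun t ht ↦ ?_
    have ht : 0 < t := ht
    set s := ENNReal.ofReal t with hs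
    have hs0 : s ≠ 0 := by simp [hs, ht]
    have hst : s ≠ ⊤ := ENNReal.ofReal_ne_top
    rw [mul_left_comm, ← mul_add]
    refine mul_le_mul_right ?_ _
    -- Below `N` the truncation does not change the level set at `s`, so the good-λ inequality
    -- applies; from `N` on, the left set is empty because `K ≥ 1`.
    by_cases hsN : s < N
    · have hsub : {x | s < K⁻¹ * min (sqCarleson μ ν x) N} ⊆
          {x | K * s < sqCarleson μ ν x ∧ maximal μ φ x ≤ γ * s} ∪
            {x | s < γ⁻¹ * maximal μ φ x} := by
        intro x hx
        have hx : s < K⁻¹ * min (sqCarleson μ ν x) N := hx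
        have hx' : K * s < sqCarleson μ ν x := by
          have h1 : s < sqCarleson μ ν x / K := by
            rw [div_eq_mul_inv, mul_comm]
            exact hx.trans_le (by gcongr; exact min_le_left _ _)
          rw [mul_comm]
          exact (ENNReal.lt_div_iff_mul_lt (Or.inl hK0) (Or.inl hK')).1 h1
        by_cases hxm : maximal μ φ x ≤ γ * s
        · exact Or.inl ⟨hx', hxm⟩
        · refine Or.inr ?_
          have : s * γ < maximal μ φ x := by rw [mul_comm]; exact not_le.1 hxm
          have := (ENNReal.lt_div_iff_mul_lt (Or.inl hγ0) (Or.inl hγt)).2 this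
          rwa [div_eq_mul_inv, mul_comm] at this
      have heq : {x | s < min (sqCarleson μ ν x) N} = {x | s < sqCarleson μ ν x} := by
        ext x
        simp [hsN]
      rw [heq]
      exact (measure_mono hsub).trans ((measure_union_le _ _).trans (add_le_add
        (h.good_lambda (by linarith) hloc hν hν' hs0 hst hK hK' hγ1 hγ) le_rfl))
    · have : {x | s < K⁻¹ * min (sqCarleson μ ν x) N} = ∅ := by
        refine eq_empty_of_forall_notMem fun x hx ↦ hsN (lt_of_lt_of_le hx ?_)
        calc K⁻¹ * min (sqCarleson μ ν x) N ≤ 1 * N := by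
              gcongr
              · exact ENNReal.inv_le_one.2 hK1
              · exact min_le_right _ _
          _ = N := one_mul _
      simp [this]
  have hlhs : I = K ^ Q * ∫⁻ x, (K⁻¹ * min (sqCarleson μ ν x) N) ^ Q ∂μ := by
    rw [← lintegral_const_mul' _ _ hKQt]
    refine lintegral_congr fun x ↦ ?_
    rw [← ENNReal.mul_rpow_of_nonneg _ _ hQ0.le, ← mul_assoc, ENNReal.mul_inv_cancel hK0 hK',
      one_mul]
  have hrhs : ∫⁻ x, (γ⁻¹ * maximal μ φ x) ^ Q ∂μ ≤ γ⁻¹ ^ Q * (C * ∫⁻ x, φ x ^ Q ∂μ) := by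
    simp only [ENNReal.mul_rpow_of_nonneg _ _ hQ0.le]
    rw [lintegral_const_mul _ (hm.pow_const Q)]
    gcongr
    exact hmax φ hφ
  set J := K ^ Q * (γ⁻¹ ^ Q * (C * ∫⁻ x, φ x ^ Q ∂μ)) with hJ
  have hfinal : I ≤ 2⁻¹ * I + J := by
    calc I = K ^ Q * ∫⁻ x, (K⁻¹ * min (sqCarleson μ ν x) N) ^ Q ∂μ := hlhs
      _ ≤ K ^ Q * (ε * I + γ⁻¹ ^ Q * (C * ∫⁻ x, φ x ^ Q ∂μ)) := by
          gcongr
          exact hmain.trans (by gcongr)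
      _ = K ^ Q * ε * I + J := by rw [hJ]; ring
      _ ≤ _ := by gcongr
  -- Absorption, legitimate because `I` is finite.
  have hhalf : 2⁻¹ * I ≤ J := by
    have hsplit : I = 2⁻¹ * I + 2⁻¹ * I := by
      rw [← add_mul, ENNReal.inv_two_add_inv_two, one_mul]
    nth_rewrite 1 [hsplit] at hfinal
    exact (ENNReal.add_le_add_iff_left (ENNReal.mul_ne_top (by simp) hIt)).1 hfinal
  calc I = 2 * (2⁻¹ * I) := by
        rw [← mul_assoc, ENNReal.mul_inv_cancel (by simp) (by simp), one_mul]
    _ ≤ 2 * J := by gcongr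
    _ = _ := by rw [hJ]; ring

end DoublingWith

end GoodLambda

/-! ### From the operator to measures: the a priori estimate on `L²`. -/

section Apriori

theorem eLpNorm_ofReal_rpow {X E : Type*} [MeasurableSpace X] [ENorm E] (ν : Measure X)
    (f : X → E) {q : ℝ} (hq : 0 < q) :
    eLpNorm f (ENNReal.ofReal q) ν ^ q = ∫⁻ x, ‖f x‖ₑ ^ q ∂ν := by
  rw [eLpNorm_eq_lintegral_rpow_enorm_toReal (by simpa using hq) ENNReal.ofReal_ne_top,
    ENNReal.toReal_ofReal hq.le, ← ENNReal.rpow_mul, one_div_mul_cancel hq.ne', ENNReal.rpow_one]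

theorem eLpNorm_two_sq {X E : Type*} [MeasurableSpace X] [ENorm E] (ν : Measure X)
    (f : X → E) : eLpNorm f 2 ν ^ 2 = ∫⁻ x, ‖f x‖ₑ ^ 2 ∂ν := by
  have := eLpNorm_ofReal_rpow ν f (q := 2) two_pos
  simpa only [ENNReal.ofReal_ofNat, ENNReal.rpow_two] using this

theorem iSup_rpow {ι : Sort*} (f : ι → ℝ≥0∞) {q : ℝ} (hq : 0 < q) :
    (⨆ i, f i) ^ q = ⨆ i, f i ^ q :=
  (ENNReal.orderIsoRpow q hq).map_iSup f

variable {M : Type*} [MetricSpace M] [MeasurableSpace M] {μ : Measure M} {D : ℝ≥0∞}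
  {H : Type*} [NormedAddCommGroup H]

/-- The measure with density `|F|²` with respect to `dt/t ⊗ dμ`. -/
noncomputable def energy (μ : Measure M) (F : ℝ × M → H) : Measure (ℝ × M) :=
  (tentMeasure μ).withDensity fun z ↦ ‖F z‖ₑ ^ 2

instance [SFinite μ] : SFinite (tentMeasure μ) := by
  unfold tentMeasure
  infer_instance

instance [SFinite μ] (F : ℝ × M → H) : SFinite (energy μ F) := by
  unfold energy
  infer_instance

variable [BorelSpace M] [SecondCountableTopology M]

theorem area_eq [SFinite μ] {F : ℝ × M → H} (hF : Measurable fun z ↦ ‖F z‖ₑ) (x : M) :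
    area μ F x = sqArea μ (energy μ F) x ^ (1 / 2 : ℝ) := by
  have hV : Measurable fun z : ℝ × M ↦ (μ (ball x z.1))⁻¹ :=
    (measurable_measure_ball.comp (by fun_prop : Measurable fun z : ℝ × M ↦ (x, z.1))).inv
  rw [area, sqArea, energy, restrict_withDensity (measurableSet_cone x),
    lintegral_withDensity_eq_lintegral_mul _ (hF.pow_const 2) hV]
  rfl

theorem area_sq [SFinite μ] {F : ℝ × M → H} (hF : Measurable fun z ↦ ‖F z‖ₑ) (x : M) :
    area μ F x ^ (2 : ℝ) = sqArea μ (energy μ F) x := by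
  rw [area_eq hF, ← ENNReal.rpow_mul]
  norm_num

theorem area_rpow [SFinite μ] {F : ℝ × M → H} (hF : Measurable fun z ↦ ‖F z‖ₑ) (x : M) (q : ℝ) :
    area μ F x ^ q = sqArea μ (energy μ F) x ^ (q / 2) := by
  rw [area_eq hF, ← ENNReal.rpow_mul]
  ring_nf

theorem measurable_area [SFinite μ] {F : ℝ × M → H} (hF : Measurable fun z ↦ ‖F z‖ₑ) :
    Measurable (area μ F) := by
  rw [funext (area_eq hF)]
  exact (measurable_sqArea _).pow_const _

theorem energy_tent (F : ℝ × M → H) (O : Set M) :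
    energy μ F (tent O) = ∫⁻ z in tent O, ‖F z‖ₑ ^ 2 ∂(tentMeasure μ) :=
  withDensity_apply _ (measurableSet_tent O)

theorem carleson_eq (F : ℝ × M → H) (x : M) :
    carleson μ F x = sqCarleson μ (energy μ F) x ^ (1 / 2 : ℝ) := by
  simp only [carleson, sqCarleson, ballSup, iSup_rpow _ one_half_pos, energy_tent]

theorem tentMeasure_compl : tentMeasure μ {z : ℝ × M | 0 < z.1}ᶜ = 0 := by
  have : {z : ℝ × M | 0 < z.1}ᶜ = (Ioi (0 : ℝ))ᶜ ×ˢ (univ : Set M) := by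
    ext z; simp
  rw [this]
  refine le_antisymm ((Measure.prod_prod_le _ _).trans_eq ?_) zero_le
  rw [withDensity_absolutelyContinuous _ _ (by simp [Iic_inter_Ioi]), zero_mul]

theorem tent_univ : tent (univ : Set M) = {z | 0 < z.1} := by
  simp [tent]

theorem energy_univ (F : ℝ × M → H) : energy μ F univ = energy μ F (tent univ) := by
  refine (measure_eq_measure_of_null_sdiff (subset_univ _) ?_).symm
  rw [tent_univ, ← compl_eq_univ_sdiff]
  exact withDensity_absolutelyContinuous _ _ tentMeasure_compl

theorem tentNorm_rpow [SFinite μ] (F : TentFun H μ) {q : ℝ} (hq : 0 < q) :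
    tentNorm (ENNReal.ofReal q) F ^ q = ∫⁻ x, sqArea μ (energy μ F) x ^ (q / 2) ∂μ := by
  rw [tentNorm, eLpNorm_ofReal_rpow _ _ hq]
  simp only [enorm_eq_self]
  exact lintegral_congr fun x ↦ area_rpow (F.stronglyMeasurable.enorm) x q

theorem DoublingWith.energy_univ_le (h : DoublingWith μ D) [SFinite μ] (F : TentFun H μ) :
    energy μ F univ ≤ D * tentNorm 2 F ^ 2 := by
  rw [energy_univ]
  refine (h.measure_tent_le_lintegral_sqArea _ _ MeasurableSet.univ).trans_eq ?_
  have := tentNorm_rpow F (q := 2) two_pos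
  rw [ENNReal.ofReal_ofNat, ENNReal.rpow_two] at this
  rw [this, Measure.restrict_univ]
  simp

variable {𝕜 : Type*} [RCLike 𝕜] [InnerProductSpace 𝕜 H]

theorem coeFn_cutOff (f : Lp 𝕜 2 μ) (c : M) (r : ℝ) :
    cutOff f c r =ᵐ[μ] (ball c r)ᶜ.indicator f := by
  rw [cutOff]
  exact MemLp.coeFn_toLp _

theorem enorm_sub_cutOff_sq (f : Lp 𝕜 2 μ) (c : M) (r : ℝ) :
    ‖f - cutOff f c r‖ₑ ^ 2 = ∫⁻ y in ball c r, ‖f y‖ₑ ^ 2 ∂μ := by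
  rw [Lp.enorm_def, eLpNorm_two_sq, ← lintegral_indicator measurableSet_ball]
  refine lintegral_congr_ae ?_
  filter_upwards [Lp.coeFn_sub f (cutOff f c r), coeFn_cutOff f c r] with x h1 h2
  rw [h1, Pi.sub_apply, h2]
  by_cases hx : x ∈ ball c r <;> simp [hx]

theorem area_indicator_tent_eq_zero [SFinite μ] (F : ℝ × M → H) {O : Set M} {x : M} (hx : x ∉ O) :
    area μ ((tent O).indicator F) x = 0 := by
  rw [area, setLIntegral_congr_fun (g := fun _ ↦ 0) (measurableSet_cone x)]
  · simp
  · intro z hz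
    have : z ∉ tent O := fun h ↦ hx ((mem_tent.1 h).2 (mem_cone.1 hz))
    simp [indicator_of_notMem this]

/-- `f` is split into its restriction to `αB` and `g`. The `L²` bound of `T` makes the energy of the
inner part at most a constant times `∫_{αB} |f|²`, which doubling compares with `μ(B) ℳ(|f|²)`. For
`g` the local estimate applies; cutting `T g` to the tent over `B` loses nothing, as only tents over
subsets of `B` are tested. -/
theorem DoublingWith.localSplitting (h : DoublingWith μ D) [SFinite μ]
    {T : Lp 𝕜 2 μ →ₗ[𝕜] TentFun H μ} (hT : IsBoundedToTent T) {p α : ℝ} (hp : 2 < p) (hα : 1 < α)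
    (hloc : LocalEstimate T p α) :
    ∃ C : ℝ≥0∞, C ≠ ⊤ ∧ ∀ f : Lp 𝕜 2 μ,
      LocalSplitting μ (energy μ (T f)) (fun x ↦ ‖f x‖ₑ ^ 2) C (p / 2) := by
  obtain ⟨C₀, hC₀⟩ := hT
  obtain ⟨C₁, hC₁⟩ := hloc
  have hp0 : 0 < p := by linarith
  obtain ⟨k, hk⟩ := pow_unbounded_of_one_lt α one_lt_two
  set A : ℝ≥0∞ := 2 * (D * C₀ ^ 2 * D ^ k) with hA
  set B : ℝ≥0∞ := 2 ^ (p / 2) * (C₁ ^ p * 2 ^ p) with hB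
  have hAt : A ≠ ⊤ := ENNReal.mul_ne_top (by simp) (ENNReal.mul_ne_top
    (ENNReal.mul_ne_top h.ne_top (ENNReal.pow_ne_top ENNReal.coe_ne_top)) (h.pow_ne_top k))
  have hBt : B ≠ ⊤ := ENNReal.mul_ne_top (ENNReal.rpow_ne_top_of_nonneg (by positivity) (by simp))
    (ENNReal.mul_ne_top (ENNReal.rpow_ne_top_of_nonneg hp0.le ENNReal.coe_ne_top)
      (ENNReal.rpow_ne_top_of_nonneg hp0.le (by simp)))
  refine ⟨A + B, ENNReal.add_ne_top.2 ⟨hAt, hBt⟩, fun f c r hr ↦ ?_⟩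
  set g := cutOff f c (α * r) with hg
  set G : ℝ × M → H := (tent (ball c r)).indicator (T g) with hG
  have hGm : Measurable fun z ↦ ‖G z‖ₑ :=
    ((T g).stronglyMeasurable.indicator (measurableSet_tent _)).enorm
  have hTm : Measurable fun z ↦ ‖T (f - g) z‖ₑ := (T (f - g)).stronglyMeasurable.enorm
  have hrα : r ≤ α * r := le_mul_of_one_le_left hr.le hα.le
  -- The factors `2` come from `|a + b|² ≤ 2|a|² + 2|b|²`.
  refine ⟨(2 : ℝ≥0∞) • energy μ (T (f - g)), (2 : ℝ≥0∞) • energy μ G, inferInstance,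
    inferInstance, fun O hO ↦ ?_, fun y hy ↦ ?_, fun y hy y' hy' ↦ ?_⟩
  · simp only [Measure.smul_apply, smul_eq_mul, energy_tent]
    rw [← lintegral_const_mul _ (hTm.pow_const 2), ← lintegral_const_mul _ (hGm.pow_const 2),
      ← lintegral_add_left ((hTm.pow_const 2).const_mul 2)]
    refine setLIntegral_mono_ae' (measurableSet_tent O) ?_
    have hsum : T f = T (f - g) + T g := by rw [← map_add, sub_add_cancel]
    have hae : (T f : ℝ × M → H) =ᵐ[tentMeasure μ] T (f - g) + T g := by
      conv_lhs => rw [hsum]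
      exact AEEqFun.coeFn_add _ _
    filter_upwards [hae] with z hz hzO
    have hGz : G z = T g z := indicator_of_mem (tent_mono hO hzO) _
    rw [hz, Pi.add_apply, hGz, ← mul_add]
    calc ‖T (f - g) z + T g z‖ₑ ^ 2 ≤ (‖T (f - g) z‖ₑ + ‖T g z‖ₑ) ^ 2 := by
          gcongr
          exact enorm_add_le _ _
      _ ≤ 2 ^ (2 - 1) * (‖T (f - g) z‖ₑ ^ 2 + ‖T g z‖ₑ ^ 2) := by
          have := ENNReal.rpow_add_le_mul_rpow_add_rpow ‖T (f - g) z‖ₑ ‖T g z‖ₑ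
            (p := 2) (by norm_num)
          norm_num at this ⊢
          exact this
      _ = _ := by norm_num
  · simp only [Measure.smul_apply, smul_eq_mul]
    calc 2 * energy μ (T (f - g)) univ ≤ 2 * (D * (C₀ * ‖f - g‖ₑ) ^ 2) := by
          gcongr
          exact (h.energy_univ_le _).trans (by gcongr; exact hC₀ _)
      _ = 2 * (D * C₀ ^ 2 * ∫⁻ y in ball c (α * r), ‖f y‖ₑ ^ 2 ∂μ) := by
          rw [mul_pow, enorm_sub_cutOff_sq]
          ring
      _ ≤ 2 * (D * C₀ ^ 2 * (maximal μ (fun x ↦ ‖f x‖ₑ ^ 2) y * (D ^ k * μ (ball c r)))) := by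
          gcongr
          refine (h.le_ballSup_mul (fun c r ↦ ∫⁻ y in ball c r, ‖f y‖ₑ ^ 2 ∂μ)
            (ball_subset_ball hrα hy)).trans ?_
          refine mul_le_mul' le_rfl (h.measure_ball_le hr k ?_)
          rw [dist_self, add_zero]
          gcongr
      _ = A * μ (ball c r) * maximal μ (fun x ↦ ‖f x‖ₑ ^ 2) y := by rw [hA]; ring
      _ ≤ _ := by
          gcongr
          exact le_self_add
  · set κ := sqCarleson μ (energy μ (T f)) y with hκ
    set m := maximal μ (fun x ↦ ‖f x‖ₑ ^ 2) y' with hm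
    have h0 := h.ne_zero c r hr
    have ht := h.finite c r
    have e1 : ∀ x, sqArea μ ((2 : ℝ≥0∞) • energy μ G) x ^ (p / 2) =
        2 ^ (p / 2) * area μ G x ^ p := by
      intro x
      rw [area_rpow hGm, ← ENNReal.mul_rpow_of_nonneg _ _ (by positivity)]
      congr 1
      rw [sqArea, Measure.restrict_smul, lintegral_smul_measure]
      rfl
    -- The hypothesis integrates over the ball only, which is the full integral because cones with
    -- vertex off the ball miss its tent.
    have e2 : ∫⁻ x, area μ G x ^ p ∂μ = ∫⁻ x in ball c r, area μ G x ^ p ∂μ := by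
      rw [← lintegral_indicator measurableSet_ball]
      refine lintegral_congr fun x ↦ ?_
      by_cases hx : x ∈ ball c r
      · rw [indicator_of_mem hx]
      · rw [indicator_of_notMem hx, hG, area_indicator_tent_eq_zero _ hx,
          ENNReal.zero_rpow_of_pos hp0]
    have e3 : (∫⁻ x in ball c r, area μ G x ^ p ∂μ) / μ (ball c r) ≤
        C₁ ^ p * 2 ^ p * (κ + m) ^ (p / 2) := by
      have h1 := hC₁ c r hr f
      have h2 : (⨅ y ∈ ball c r, carleson μ (T f) y) +
          (⨅ y ∈ ball c r, maximal μ (fun w ↦ ‖f w‖ₑ ^ 2) y ^ (1 / 2 : ℝ)) ≤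
          2 * (κ + m) ^ (1 / 2 : ℝ) := by
        rw [two_mul]
        refine add_le_add ((biInf_le _ hy).trans ?_) ((biInf_le _ hy').trans ?_)
        · rw [carleson_eq]
          gcongr
          exact le_self_add
        · gcongr
          exact le_add_self
      have h3 := h1.trans (mul_le_mul_right h2 _)
      rw [one_div p, ENNReal.rpow_inv_le_iff hp0] at h3
      refine h3.trans_eq ?_
      rw [ENNReal.mul_rpow_of_nonneg _ _ hp0.le, ENNReal.mul_rpow_of_nonneg _ _ hp0.le,
        ← ENNReal.rpow_mul, ← mul_assoc]
      congr 2
      ring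
    rw [ENNReal.div_le_iff h0 ht] at e3
    calc ∫⁻ x, sqArea μ ((2 : ℝ≥0∞) • energy μ G) x ^ (p / 2) ∂μ
        = 2 ^ (p / 2) * ∫⁻ x in ball c r, area μ G x ^ p ∂μ := by
          simp only [e1]
          rw [lintegral_const_mul' _ _ (ENNReal.rpow_ne_top_of_nonneg (by positivity) (by simp)),
            e2]
      _ ≤ 2 ^ (p / 2) * (C₁ ^ p * 2 ^ p * (κ + m) ^ (p / 2) * μ (ball c r)) := by gcongr
      _ = B * μ (ball c r) * (κ + m) ^ (p / 2) := by rw [hB]; ring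
      _ ≤ _ := by
          gcongr
          exact le_add_self

/-- The a priori estimate on `L²`. -/
theorem DoublingWith.exists_tentNorm_le (h : DoublingWith μ D) [SFinite μ]
    {T : Lp 𝕜 2 μ →ₗ[𝕜] TentFun H μ} (hT : IsBoundedToTent T) {p α : ℝ} (hp : 2 < p) (hα : 1 < α)
    (hloc : LocalEstimate T p α) {q : ℝ} (hq : 2 < q) (hqp : q < p) :
    ∃ C : ℝ≥0, ∀ f : Lp 𝕜 2 μ, tentNorm (ENNReal.ofReal q) (T f) ≤
      C * eLpNorm f (ENNReal.ofReal q) μ := by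
  obtain ⟨C₁, hC₁, hsplit⟩ := h.localSplitting hT hp hα hloc
  obtain ⟨C₀, hC₀⟩ := hT
  have hq0 : 0 < q := by linarith
  -- Exponents are halved since squares are estimated; `D * C₀ ^ 2` bounds the total energy of `T f`
  -- in terms of `∫ |f|²`.
  obtain ⟨C₂, hC₂, h2⟩ := h.lintegral_sqCarleson_rpow_le (C₀ := D * C₀ ^ 2)
    (ENNReal.mul_ne_top h.ne_top (ENNReal.pow_ne_top ENNReal.coe_ne_top)) hC₁
    (Q := q / 2) (P := p / 2) (by linarith) (by linarith)
  obtain ⟨C₃, hC₃, h3⟩ := h.lintegral_sqArea_rpow_le (Q := q / 2) (by linarith)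
  have hCt : (C₃ * C₂) ^ (1 / q) ≠ ⊤ :=
    ENNReal.rpow_ne_top_of_nonneg (by positivity) (ENNReal.mul_ne_top hC₃ hC₂)
  refine ⟨((C₃ * C₂) ^ (1 / q)).toNNReal, fun f ↦ ?_⟩
  rw [ENNReal.coe_toNNReal hCt, ← ENNReal.rpow_le_rpow_iff hq0,
    ENNReal.mul_rpow_of_nonneg _ _ hq0.le, ← ENNReal.rpow_mul, one_div_mul_cancel hq0.ne',
    ENNReal.rpow_one, tentNorm_rpow _ hq0, eLpNorm_ofReal_rpow _ _ hq0, mul_assoc]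
  refine (h3 _).trans (mul_le_mul_right ?_ _)
  have hfm : Measurable fun x ↦ ‖f x‖ₑ := (Lp.stronglyMeasurable f).enorm
  refine (h2 (energy μ (T f)) (fun x ↦ ‖f x‖ₑ ^ 2) (hfm.pow_const 2) ?_ ?_ (hsplit f)).trans_eq ?_
  · rw [← eLpNorm_two_sq]
    exact ENNReal.pow_ne_top (Lp.eLpNorm_ne_top f)
  · rw [← eLpNorm_two_sq, mul_assoc, ← mul_pow, ← Lp.enorm_def]
    refine (h.energy_univ_le _).trans ?_
    gcongr
    exact hC₀ f
  · congr 1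
    refine lintegral_congr fun x ↦ ?_
    rw [← ENNReal.rpow_two, ← ENNReal.rpow_mul]
    congr 1
    ring

end Apriori

/-! ### Tent spaces as complete normed spaces. -/

section TentSpace

variable {M : Type*} [MetricSpace M] [MeasurableSpace M] {μ : Measure M} {D : ℝ≥0∞}
  {H : Type*} [NormedAddCommGroup H] [BorelSpace M] [SecondCountableTopology M]

/-- The area function at `x` is the `L²` norm for this measure. -/
noncomputable def coneMeasure (μ : Measure M) (x : M) : Measure (ℝ × M) :=
  ((tentMeasure μ).restrict (cone x)).withDensity fun z ↦ (μ (ball x z.1))⁻¹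

theorem coneMeasure_absolutelyContinuous (x : M) : coneMeasure μ x ≪ tentMeasure μ :=
  (withDensity_absolutelyContinuous _ _).trans Measure.restrict_le_self.absolutelyContinuous

theorem area_eq_eLpNorm [SFinite μ] (F : TentFun H μ) (x : M) :
    area μ F x = eLpNorm F 2 (coneMeasure μ x) := by
  have hV : Measurable fun z : ℝ × M ↦ (μ (ball x z.1))⁻¹ :=
    (measurable_measure_ball.comp (by fun_prop : Measurable fun z : ℝ × M ↦ (x, z.1))).inv
  have h2 := eLpNorm_two_sq (coneMeasure μ x) F
  rw [coneMeasure, lintegral_withDensity_eq_lintegral_mul _ hV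
    (F.stronglyMeasurable.enorm.pow_const 2)] at h2
  rw [area, coneMeasure]
  have h3 : ∫⁻ z in cone x, ‖F z‖ₑ ^ 2 / μ (ball x z.1) ∂(tentMeasure μ) =
      eLpNorm F 2 (((tentMeasure μ).restrict (cone x)).withDensity
        fun z ↦ (μ (ball x z.1))⁻¹) ^ 2 := by
    rw [h2]
    refine lintegral_congr fun z ↦ ?_
    rw [Pi.mul_apply, mul_comm, div_eq_mul_inv]
  rw [h3, ← ENNReal.rpow_two, ← ENNReal.rpow_mul]
  norm_num

theorem area_add_le [SFinite μ] (F G : TentFun H μ) (x : M) :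
    area μ (F + G : TentFun H μ) x ≤ area μ F x + area μ G x := by
  simp only [area_eq_eLpNorm]
  rw [eLpNorm_congr_ae ((coneMeasure_absolutelyContinuous x).ae_eq (AEEqFun.coeFn_add F G))]
  exact eLpNorm_add_le F.stronglyMeasurable.aestronglyMeasurable
    G.stronglyMeasurable.aestronglyMeasurable (by norm_num)

theorem tentNorm_add_le [SFinite μ] (F G : TentFun H μ) {p : ℝ≥0∞} (hp : 1 ≤ p) :
    tentNorm p (F + G) ≤ tentNorm p F + tentNorm p G := by
  have hF := measurable_area (μ := μ) F.stronglyMeasurable.enorm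
  have hG := measurable_area (μ := μ) G.stronglyMeasurable.enorm
  refine le_trans (eLpNorm_mono_enorm (g := area μ F + area μ G) fun x ↦ ?_)
    (eLpNorm_add_le hF.aestronglyMeasurable hG.aestronglyMeasurable hp)
  simpa only [enorm_eq_self, Pi.add_apply] using area_add_le F G x

theorem tentNorm_neg [SFinite μ] (F : TentFun H μ) (p : ℝ≥0∞) :
    tentNorm p (-F) = tentNorm p F := by
  rw [tentNorm, tentNorm]
  congr 1
  ext x
  rw [area_eq_eLpNorm, area_eq_eLpNorm,
    eLpNorm_congr_ae ((coneMeasure_absolutelyContinuous x).ae_eq (AEEqFun.coeFn_neg F)),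
    eLpNorm_neg]

theorem tentNorm_sub_comm [SFinite μ] (F G : TentFun H μ) (p : ℝ≥0∞) :
    tentNorm p (F - G) = tentNorm p (G - F) := by
  rw [← neg_sub, tentNorm_neg]

theorem tentNorm_smul [SFinite μ] {𝕜 : Type*} [RCLike 𝕜] [InnerProductSpace 𝕜 H] (c : 𝕜)
    (F : TentFun H μ) {q : ℝ} (hq : 0 < q) :
    tentNorm (ENNReal.ofReal q) (c • F) = ‖c‖ₑ * tentNorm (ENNReal.ofReal q) F := by
  have harea : ∀ x, area μ (c • F : TentFun H μ) x = ‖c‖ₑ * area μ F x := fun x ↦ by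
    rw [area_eq_eLpNorm, area_eq_eLpNorm,
      eLpNorm_congr_ae ((coneMeasure_absolutelyContinuous x).ae_eq (AEEqFun.coeFn_smul c F)),
      eLpNorm_const_smul]
  apply ENNReal.rpow_left_injective hq.ne'
  dsimp only
  rw [ENNReal.mul_rpow_of_nonneg _ _ hq.le, tentNorm, tentNorm, eLpNorm_ofReal_rpow _ _ hq,
    eLpNorm_ofReal_rpow _ _ hq, ← lintegral_const_mul' _ _
      (ENNReal.rpow_ne_top_of_nonneg hq.le enorm_ne_top)]
  simp only [enorm_eq_self, harea, ENNReal.mul_rpow_of_nonneg _ _ hq.le]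

theorem ae_of_forall_tent_ball {x₀ : M} {P : ℝ × M → Prop}
    (hP : ∀ N : ℕ, ∀ᵐ z ∂(tentMeasure μ).restrict (tent (ball x₀ (N : ℝ))), P z) :
    ∀ᵐ z ∂(tentMeasure μ), P z := by
  have h1 := (ae_restrict_iUnion_iff (fun N : ℕ ↦ tent (ball x₀ (N : ℝ))) P).2 hP
  have hcov : {z : ℝ × M | 0 < z.1} ⊆ ⋃ N : ℕ, tent (ball x₀ (N : ℝ)) := by
    intro z hz
    obtain ⟨N, hN⟩ := exists_nat_ge (z.1 + dist z.2 x₀)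
    exact mem_iUnion.2 ⟨N, mem_tent.2 ⟨hz, ball_subset_ball' hN⟩⟩
  rw [ae_restrict_iff' (MeasurableSet.iUnion fun N ↦ measurableSet_tent _)] at h1
  have h2 : ∀ᵐ z ∂(tentMeasure μ), z ∈ {z : ℝ × M | 0 < z.1} := tentMeasure_compl
  filter_upwards [h1, h2] with z hz hz0
  exact hz (hcov hz0)

/-- The tent space norm controls the `L²` norm on the tents over balls. -/
theorem DoublingWith.exists_eLpNorm_tent_le (h : DoublingWith μ D) [SFinite μ] (c : M) (r : ℝ)
    {p : ℝ≥0∞} (hp : 2 ≤ p) :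
    ∃ C : ℝ≥0∞, C ≠ ⊤ ∧ ∀ F : TentFun H μ,
      eLpNorm F 2 ((tentMeasure μ).restrict (tent (ball c r))) ≤ C * tentNorm p F := by
  set B := ball c r with hB
  have hinv : p.toReal⁻¹ ≤ 2⁻¹ := by
    -- At `p = ⊤` the convention `⊤.toReal = 0` gives inverse exponent `0`, as it should.
    rcases eq_or_ne p ⊤ with rfl | hpt
    · simp
    · have : 2 ≤ p.toReal := by simpa using ENNReal.toReal_mono hpt hp
      gcongr
  refine ⟨D * μ B ^ (1 / (2 : ℝ≥0∞).toReal - 1 / p.toReal), ENNReal.mul_ne_top h.ne_top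
    (ENNReal.rpow_ne_top_of_nonneg (by simpa using hinv) (h.finite c r)), fun F ↦ ?_⟩
  have ha := measurable_area (μ := μ) F.stronglyMeasurable.enorm
  have h1 : eLpNorm (area μ F) 2 (μ.restrict B) ≤
      tentNorm p F * μ B ^ (1 / (2 : ℝ≥0∞).toReal - 1 / p.toReal) := by
    have := eLpNorm_le_eLpNorm_mul_rpow_measure_univ (μ := μ.restrict B) hp
      ha.aestronglyMeasurable
    rw [Measure.restrict_apply_univ] at this
    refine this.trans ?_
    gcongr
    exact eLpNorm_mono_measure _ Measure.restrict_le_self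
  rw [← ENNReal.pow_le_pow_left_iff two_ne_zero, eLpNorm_two_sq, ← energy_tent]
  calc energy μ F (tent B) ≤ D * ∫⁻ x in B, sqArea μ (energy μ F) x ∂μ :=
        h.measure_tent_le_lintegral_sqArea _ _ measurableSet_ball
    _ = D * eLpNorm (area μ F) 2 (μ.restrict B) ^ 2 := by
        rw [eLpNorm_two_sq]
        congr 1
        refine lintegral_congr fun x ↦ ?_
        rw [← area_sq F.stronglyMeasurable.enorm, enorm_eq_self, ENNReal.rpow_two]
    _ ≤ D * D * (tentNorm p F * μ B ^ (1 / (2 : ℝ≥0∞).toReal - 1 / p.toReal)) ^ 2 := by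
        gcongr
        exact le_mul_of_one_le_left' h.one_le
    _ = _ := by ring

/-- `F` vanishes in `L²` of each tent over a ball, and these tents exhaust the half space.
Uniqueness of limits, and with it linearity of the extension, rests on this. -/
theorem DoublingWith.eq_zero_of_tentNorm_eq_zero (h : DoublingWith μ D) [SFinite μ] [Nonempty M]
    {p : ℝ≥0∞} (hp : 2 ≤ p) {F : TentFun H μ} (hF : tentNorm p F = 0) : F = 0 := by
  obtain ⟨x₀⟩ := ‹Nonempty M›
  refine AEEqFun.ext ?_
  have : ∀ᵐ z ∂(tentMeasure μ), F z = 0 := by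
    refine ae_of_forall_tent_ball (x₀ := x₀) fun N ↦ ?_
    obtain ⟨C, -, hC⟩ := h.exists_eLpNorm_tent_le (H := H) x₀ N hp
    have h1 := hC F
    rw [hF, mul_zero, nonpos_iff_eq_zero,
      eLpNorm_eq_zero_iff F.stronglyMeasurable.aestronglyMeasurable two_ne_zero] at h1
    exact h1
  filter_upwards [this, AEEqFun.coeFn_zero (μ := tentMeasure μ) (β := H)] with z h1 h2
  rw [h1, h2, Pi.zero_apply]

theorem sqArea_energy_eq_lintegral [SFinite μ] (F : TentFun H μ) (x : M) :
    sqArea μ (energy μ F) x = ∫⁻ z, ‖F z‖ₑ ^ 2 ∂(coneMeasure μ x) := by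
  rw [← area_sq F.stronglyMeasurable.enorm, area_eq_eLpNorm, ENNReal.rpow_two, eLpNorm_two_sq]

/-- Fatou's lemma in tent spaces. -/
theorem tentNorm_le_of_tendsto [SFinite μ] {q : ℝ} (hq : 0 < q) {G : ℕ → TentFun H μ}
    {F : TentFun H μ} (hG : ∀ᵐ z ∂(tentMeasure μ), Tendsto (fun n ↦ G n z) atTop (𝓝 (F z)))
    {K : ℝ≥0∞} (hK : ∀ᶠ n in atTop, tentNorm (ENNReal.ofReal q) (G n) ≤ K) :
    tentNorm (ENNReal.ofReal q) F ≤ K := by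
  rw [← ENNReal.rpow_le_rpow_iff hq, tentNorm_rpow _ hq]
  have hq2 : 0 < q / 2 := by positivity
  have hpt : ∀ x, sqArea μ (energy μ F) x ^ (q / 2) ≤
      liminf (fun n ↦ sqArea μ (energy μ (G n)) x ^ (q / 2)) atTop := by
    intro x
    have h1 : sqArea μ (energy μ F) x ≤ liminf (fun n ↦ sqArea μ (energy μ (G n)) x) atTop := by
      simp only [sqArea_energy_eq_lintegral]
      refine le_trans (le_of_eq ?_) (lintegral_liminf_le fun n ↦
        (G n).stronglyMeasurable.enorm.pow_const 2)
      refine lintegral_congr_ae ?_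
      filter_upwards [(coneMeasure_absolutelyContinuous x).ae_le hG] with z hz
      exact (((ENNReal.continuous_pow 2).tendsto _).comp hz.enorm).liminf_eq.symm
    calc _ ≤ (liminf (fun n ↦ sqArea μ (energy μ (G n)) x) atTop) ^ (q / 2) := by gcongr
      _ = _ := (ENNReal.orderIsoRpow (q / 2) hq2).liminf_apply
  calc ∫⁻ x, sqArea μ (energy μ F) x ^ (q / 2) ∂μ
      ≤ ∫⁻ x, liminf (fun n ↦ sqArea μ (energy μ (G n)) x ^ (q / 2)) atTop ∂μ :=
        lintegral_mono hpt
    _ ≤ liminf (fun n ↦ ∫⁻ x, sqArea μ (energy μ (G n)) x ^ (q / 2) ∂μ) atTop :=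
        lintegral_liminf_le fun n ↦ (measurable_sqArea _).pow_const _
    _ ≤ liminf (fun _ : ℕ ↦ K ^ q) atTop := by
        refine liminf_le_liminf ?_
        filter_upwards [hK] with n hn
        rw [← tentNorm_rpow _ hq]
        gcongr
    _ = K ^ q := by simp

/-- Completeness of tent spaces. -/
theorem DoublingWith.exists_tent_limit (h : DoublingWith μ D) [SFinite μ] [CompleteSpace H]
    [Nonempty M] {q : ℝ} (hq : 2 ≤ q) {G : ℕ → TentFun H μ} {a : ℕ → ℝ≥0∞}
    (ha : Tendsto a atTop (𝓝 0))
    (hG : ∀ N n m, N ≤ n → N ≤ m → tentNorm (ENNReal.ofReal q) (G n - G m) ≤ a N) :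
    ∃ F : TentFun H μ, ∀ n, tentNorm (ENNReal.ofReal q) (F - G n) ≤ a n := by
  obtain ⟨x₀⟩ := ‹Nonempty M›
  have hq2 : 2 ≤ ENNReal.ofReal q := by
    rw [← ENNReal.ofReal_ofNat]
    exact ENNReal.ofReal_le_ofReal hq
  -- A subsequence with geometric decay converges almost everywhere on each tent over a ball, by the
  -- local `L²` control. Fatou's lemma then upgrades the pointwise limit to the norm estimate.
  obtain ⟨φ, hφ, hφa⟩ := extraction_forall_of_eventually' (P := fun k n ↦ a n < 2⁻¹ ^ k)
    fun k ↦ by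
      obtain ⟨N, hN⟩ := eventually_atTop.1 (ha.eventually (gt_mem_nhds
        (ENNReal.pow_pos (by simp : (0 : ℝ≥0∞) < 2⁻¹) k)))
      exact ⟨N, hN⟩
  have hlim : ∀ᵐ z ∂(tentMeasure μ), ∃ l, Tendsto (fun k ↦ G (φ k) z) atTop (𝓝 l) := by
    refine ae_of_forall_tent_ball (x₀ := x₀) fun N ↦ ?_
    obtain ⟨C, hCt, hC⟩ := h.exists_eLpNorm_tent_le (H := H) x₀ N hq2
    -- `C + 1` rather than `C`, as a strict inequality is required.
    refine Lp.ae_tendsto_of_cauchy_eLpNorm (p := 2) (B := fun k ↦ (C + 1) * 2⁻¹ ^ k)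
      (fun k ↦ (G (φ k)).stronglyMeasurable.aestronglyMeasurable) (by norm_num) ?_ ?_
    · rw [ENNReal.tsum_mul_left, ENNReal.tsum_geometric]
      exact ENNReal.mul_ne_top (by simp [hCt]) (by simp)
    · intro k n m hn hm
      have hpos : (2⁻¹ : ℝ≥0∞) ^ k ≠ 0 := by simp
      have hfin : (2⁻¹ : ℝ≥0∞) ^ k ≠ ⊤ := ENNReal.pow_ne_top (by simp)
      calc eLpNorm (G (φ n) - G (φ m) : ℝ × M → H) 2 _
          = eLpNorm (G (φ n) - G (φ m) : TentFun H μ) 2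
              ((tentMeasure μ).restrict (tent (ball x₀ N))) :=
            (eLpNorm_congr_ae (ae_restrict_of_ae (AEEqFun.coeFn_sub _ _))).symm
        _ ≤ C * tentNorm (ENNReal.ofReal q) (G (φ n) - G (φ m)) := hC _
        _ ≤ C * 2⁻¹ ^ k := by
            gcongr
            exact (hG _ _ _ (hφ.monotone hn) (hφ.monotone hm)).trans (hφa k).le
        _ < (C + 1) * 2⁻¹ ^ k := (ENNReal.mul_lt_mul_iff_left hpos hfin).2
            (ENNReal.lt_add_right hCt one_ne_zero)
  obtain ⟨F, hF, hFlim⟩ := exists_stronglyMeasurable_limit_of_tendsto_ae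
    (fun k ↦ (G (φ k)).stronglyMeasurable.aestronglyMeasurable) hlim
  refine ⟨AEEqFun.mk F hF.aestronglyMeasurable, fun n ↦ ?_⟩
  refine tentNorm_le_of_tendsto (by linarith) (G := fun k ↦ G (φ k) - G n) ?_ ?_
  · have hall : ∀ᵐ z ∂(tentMeasure μ), ∀ k, (G (φ k) - G n : TentFun H μ) z =
        G (φ k) z - G n z := ae_all_iff.2 fun k ↦ AEEqFun.coeFn_sub _ _
    filter_upwards [hFlim, hall, AEEqFun.coeFn_mk F hF.aestronglyMeasurable,
      AEEqFun.coeFn_sub (AEEqFun.mk F hF.aestronglyMeasurable) (G n)] with z h1 h2 h3 h4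
    rw [h4, Pi.sub_apply, h3]
    simp only [h2]
    exact h1.sub_const _
  · filter_upwards [eventually_ge_atTop n] with k hk
    exact hG n _ _ (hk.trans hφ.le_apply) le_rfl

end TentSpace

/-! ### Extension from `L²` to `L^q` by cutting off to balls. -/

section Extension

variable {M : Type*} [MetricSpace M] [MeasurableSpace M] {μ : Measure M} {D : ℝ≥0∞}
  {H : Type*} [NormedAddCommGroup H] [BorelSpace M] [SecondCountableTopology M]
  {𝕜 : Type*} [RCLike 𝕜] [InnerProductSpace 𝕜 H]

theorem memLp_indicator_ball (hμ : ∀ (x : M) (r : ℝ), μ (ball x r) ≠ ⊤) {p : ℝ≥0∞} (hp : 2 ≤ p)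
    (f : Lp 𝕜 p μ) (x : M) (r : ℝ) : MemLp ((ball x r).indicator f) 2 μ := by
  have : IsFiniteMeasure (μ.restrict (ball x r)) := ⟨by simpa using (hμ x r).lt_top⟩
  rw [memLp_indicator_iff_restrict measurableSet_ball]
  exact ((Lp.memLp f).restrict _).mono_exponent hp

/-- The restriction of `f` to the ball of center `x` and radius `n`, as an element of `L²`. -/
noncomputable def truncation (hμ : ∀ (x : M) (r : ℝ), μ (ball x r) ≠ ⊤) {p : ℝ≥0∞} (hp : 2 ≤ p)
    (x : M) (f : Lp 𝕜 p μ) (n : ℕ) : Lp 𝕜 2 μ :=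
  (memLp_indicator_ball hμ hp f x n).toLp _

variable {p : ℝ≥0∞}

theorem coeFn_truncation (hμ : ∀ (x : M) (r : ℝ), μ (ball x r) ≠ ⊤) (hp : 2 ≤ p)
    (x : M) (f : Lp 𝕜 p μ) (n : ℕ) :
    truncation hμ hp x f n =ᵐ[μ] (ball x (n : ℝ)).indicator f :=
  MemLp.coeFn_toLp _

theorem truncation_add (hμ : ∀ (x : M) (r : ℝ), μ (ball x r) ≠ ⊤) (hp : 2 ≤ p)
    (x : M) (f g : Lp 𝕜 p μ) (n : ℕ) :
    truncation hμ hp x (f + g) n = truncation hμ hp x f n + truncation hμ hp x g n := by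
  refine Lp.ext ?_
  filter_upwards [coeFn_truncation hμ hp x (f + g) n, coeFn_truncation hμ hp x f n,
    coeFn_truncation hμ hp x g n, Lp.coeFn_add (truncation hμ hp x f n) (truncation hμ hp x g n),
    Lp.coeFn_add f g] with y h1 h2 h3 h4 h5
  rw [h1, h4, Pi.add_apply, h2, h3]
  by_cases hy : y ∈ ball x (n : ℝ)
  · simp only [indicator_of_mem hy, h5, Pi.add_apply]
  · simp only [indicator_of_notMem hy, add_zero]

theorem truncation_smul (hμ : ∀ (x : M) (r : ℝ), μ (ball x r) ≠ ⊤) (hp : 2 ≤ p)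
    (x : M) (c : 𝕜) (f : Lp 𝕜 p μ) (n : ℕ) :
    truncation hμ hp x (c • f) n = c • truncation hμ hp x f n := by
  refine Lp.ext ?_
  filter_upwards [coeFn_truncation hμ hp x (c • f) n, coeFn_truncation hμ hp x f n,
    Lp.coeFn_smul c (truncation hμ hp x f n), Lp.coeFn_smul c f] with y h1 h2 h3 h4
  rw [h1, h3, Pi.smul_apply, h2]
  by_cases hy : y ∈ ball x (n : ℝ)
  · simp only [indicator_of_mem hy, h4, Pi.smul_apply]
  · simp only [indicator_of_notMem hy, smul_zero]

theorem eLpNorm_truncation_sub_le (hμ : ∀ (x : M) (r : ℝ), μ (ball x r) ≠ ⊤) (hp : 2 ≤ p)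
    (x : M) (f : Lp 𝕜 p μ) {N n m : ℕ} (hn : N ≤ n) (hm : N ≤ m) :
    eLpNorm (truncation hμ hp x f n - truncation hμ hp x f m : Lp 𝕜 2 μ) p μ ≤
      eLpNorm ((ball x (N : ℝ))ᶜ.indicator f) p μ := by
  refine eLpNorm_mono_enorm_ae ?_
  filter_upwards [Lp.coeFn_sub (truncation hμ hp x f n) (truncation hμ hp x f m),
    coeFn_truncation hμ hp x f n, coeFn_truncation hμ hp x f m] with y h1 h2 h3
  rw [h1, Pi.sub_apply, h2, h3]
  by_cases hy : y ∈ ball x (N : ℝ)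
  · have hyn : y ∈ ball x (n : ℝ) := ball_subset_ball (by exact_mod_cast hn) hy
    have hym : y ∈ ball x (m : ℝ) := ball_subset_ball (by exact_mod_cast hm) hy
    simp [indicator_of_mem hyn, indicator_of_mem hym]
  · rw [indicator_of_mem (mem_compl hy)]
    by_cases hyn : y ∈ ball x (n : ℝ) <;> by_cases hym : y ∈ ball x (m : ℝ) <;>
      simp only [indicator_of_mem, indicator_of_notMem, hyn, hym, not_false_eq_true, sub_self,
        sub_zero, zero_sub, enorm_neg, enorm_zero, le_refl, zero_le]

theorem eLpNorm_sub_truncation_le (hμ : ∀ (x : M) (r : ℝ), μ (ball x r) ≠ ⊤) (hp : 2 ≤ p)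
    (x : M) {f : Lp 𝕜 2 μ} {g : Lp 𝕜 p μ} (hfg : f =ᵐ[μ] g) (n : ℕ) :
    eLpNorm (f - truncation hμ hp x g n : Lp 𝕜 2 μ) p μ ≤
      eLpNorm ((ball x (n : ℝ))ᶜ.indicator g) p μ := by
  refine eLpNorm_mono_enorm_ae ?_
  filter_upwards [Lp.coeFn_sub f (truncation hμ hp x g n),
    coeFn_truncation hμ hp x g n, hfg] with y h1 h2 h3
  rw [h1, Pi.sub_apply, h2, h3]
  by_cases hy : y ∈ ball x (n : ℝ) <;> simp [hy]

theorem tendsto_eLpNorm_indicator_compl_ball {q : ℝ} (hq : 0 < q) (x : M)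
    (f : Lp 𝕜 (ENNReal.ofReal q) μ) :
    Tendsto (fun n : ℕ ↦ eLpNorm ((ball x (n : ℝ))ᶜ.indicator f) (ENNReal.ofReal q) μ) atTop
      (𝓝 0) := by
  have hfm : Measurable fun y ↦ ‖f y‖ₑ := (Lp.stronglyMeasurable f).enorm
  have h1 : Tendsto (fun n : ℕ ↦ ∫⁻ y, ‖(ball x (n : ℝ))ᶜ.indicator f y‖ₑ ^ q ∂μ) atTop
      (𝓝 (∫⁻ _, 0 ∂μ)) := by
    refine tendsto_lintegral_of_dominated_convergence (fun y ↦ ‖f y‖ₑ ^ q) (fun n ↦ ?_)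
      (fun n ↦ Eventually.of_forall fun y ↦ ?_) ?_ (Eventually.of_forall fun y ↦ ?_)
    · exact ((Lp.stronglyMeasurable f).indicator measurableSet_ball.compl).enorm.pow_const q
    · dsimp only
      gcongr
      exact enorm_indicator_le_enorm_self _ _
    · rw [← eLpNorm_ofReal_rpow _ _ hq]
      exact ENNReal.rpow_ne_top_of_nonneg hq.le (Lp.eLpNorm_ne_top f)
    · refine tendsto_const_nhds.congr' ?_
      obtain ⟨N, hN⟩ := exists_nat_gt (dist y x)
      filter_upwards [eventually_ge_atTop N] with n hn
      have hy : y ∈ ball x (n : ℝ) := hN.trans_le (by exact_mod_cast hn)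
      simp [hy, hq]
  rw [lintegral_zero] at h1
  have h2 := ((ENNReal.continuous_rpow_const (y := 1 / q)).tendsto 0).comp h1
  rw [ENNReal.zero_rpow_of_pos (by positivity)] at h2
  refine h2.congr fun n ↦ ?_
  rw [Function.comp_apply, ← eLpNorm_ofReal_rpow _ _ hq, ← ENNReal.rpow_mul,
    mul_one_div_cancel hq.ne', ENNReal.rpow_one]

/-- An operator on `L²` that satisfies an a priori estimate from `L^q` to `T^{2,q}` extends. -/
theorem DoublingWith.extendsBoundedly (h : DoublingWith μ D) [CompleteSpace H] [Nonempty M]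
    {T : Lp 𝕜 2 μ →ₗ[𝕜] TentFun H μ} {q : ℝ} (hq : 2 ≤ q) {C : ℝ≥0}
    (hC : ∀ f : Lp 𝕜 2 μ, tentNorm (ENNReal.ofReal q) (T f) ≤
      C * eLpNorm f (ENNReal.ofReal q) μ) :
    ExtendsBoundedly T (ENNReal.ofReal q) := by
  have := h.sigmaFinite
  obtain ⟨x₀⟩ := id ‹Nonempty M›
  have hq0 : 0 < q := by linarith
  have hq2 : 2 ≤ ENNReal.ofReal q := by
    rw [← ENNReal.ofReal_ofNat]
    exact ENNReal.ofReal_le_ofReal hq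
  have hq1 : 1 ≤ ENNReal.ofReal q := one_le_two.trans hq2
  set τ := fun f : Lp 𝕜 (ENNReal.ofReal q) μ ↦ truncation h.finite hq2 x₀ f with hτ
  have htail : ∀ f : Lp 𝕜 (ENNReal.ofReal q) μ, Tendsto (fun n : ℕ ↦
      C * eLpNorm ((ball x₀ (n : ℝ))ᶜ.indicator f) (ENNReal.ofReal q) μ) atTop (𝓝 0) := fun f ↦ by
    simpa using ENNReal.Tendsto.const_mul (a := (C : ℝ≥0∞))
      (tendsto_eLpNorm_indicator_compl_ball hq0 x₀ f) (Or.inr ENNReal.coe_ne_top)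
  have hex : ∀ f : Lp 𝕜 (ENNReal.ofReal q) μ, ∃ F : TentFun H μ,
      Tendsto (fun n ↦ tentNorm (ENNReal.ofReal q) (F - T (τ f n))) atTop (𝓝 0) := by
    intro f
    obtain ⟨F, hF⟩ := h.exists_tent_limit hq (G := fun n ↦ T (τ f n)) (htail f)
      fun N n m hn hm ↦ by
        rw [← map_sub]
        exact (hC _).trans (mul_le_mul_right (eLpNorm_truncation_sub_le _ _ _ f hn hm) _)
    exact ⟨F, tendsto_of_tendsto_of_tendsto_of_le_of_le tendsto_const_nhds (htail f)
      (fun _ ↦ zero_le) hF⟩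
  -- Additivity, homogeneity and agreement with `T` all reduce to this: both candidates are limits
  -- of the same sequence.
  have huniq : ∀ {F F' : TentFun H μ} {G : ℕ → TentFun H μ},
      Tendsto (fun n ↦ tentNorm (ENNReal.ofReal q) (F - G n)) atTop (𝓝 0) →
      Tendsto (fun n ↦ tentNorm (ENNReal.ofReal q) (F' - G n)) atTop (𝓝 0) → F = F' := by
    intro F F' G hF hF'
    rw [← sub_eq_zero]
    refine h.eq_zero_of_tentNorm_eq_zero hq2 (le_antisymm ?_ zero_le)
    have hsum := hF.add hF'
    rw [add_zero] at hsum
    refine ge_of_tendsto' hsum fun n ↦ ?_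
    rw [tentNorm_sub_comm F' (G n), ← sub_add_sub_cancel F (G n) F']
    exact tentNorm_add_le _ _ hq1
  choose S hS using hex
  refine ⟨{ toFun := S, map_add' := fun f g ↦ ?_, map_smul' := fun c f ↦ ?_ }, ⟨C, fun f ↦ ?_⟩,
    fun f g hfg ↦ ?_⟩
  · refine huniq (hS (f + g)) ?_
    have hsum := (hS f).add (hS g)
    rw [add_zero] at hsum
    refine tendsto_of_tendsto_of_tendsto_of_le_of_le tendsto_const_nhds hsum
      (fun _ ↦ zero_le) fun n ↦ ?_
    dsimp only
    rw [hτ]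
    dsimp only
    rw [truncation_add, map_add, add_sub_add_comm]
    exact tentNorm_add_le _ _ hq1
  · refine huniq (hS (c • f)) ?_
    have hmul := ENNReal.Tendsto.const_mul (a := ‖c‖ₑ) (hS f) (Or.inr enorm_ne_top)
    rw [mul_zero] at hmul
    refine hmul.congr fun n ↦ ?_
    rw [hτ]
    dsimp only
    rw [truncation_smul, map_smul, RingHom.id_apply, ← smul_sub, tentNorm_smul c _ hq0]
  · have hlim := (hS f).add_const (C * ‖f‖ₑ)
    rw [zero_add] at hlim
    refine ge_of_tendsto' hlim fun n ↦ ?_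
    have htn : tentNorm (ENNReal.ofReal q) (T (τ f n)) ≤ C * ‖f‖ₑ := by
      refine (hC _).trans (mul_le_mul_right ?_ _)
      rw [eLpNorm_congr_ae (coeFn_truncation _ _ _ f n), Lp.enorm_def]
      exact eLpNorm_indicator_le _
    calc tentNorm (ENNReal.ofReal q) (S f)
        = tentNorm (ENNReal.ofReal q) (S f - T (τ f n) + T (τ f n)) := by rw [sub_add_cancel]
      _ ≤ _ := (tentNorm_add_le _ _ hq1).trans (add_le_add_right htn _)
  -- The a priori estimate applies to the `L²` function `f - τ g n`, whose `L^q` norm is a tail of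
  -- `g`; convergence in `L²` plays no role.
  · refine huniq (hS g) ?_
    refine tendsto_of_tendsto_of_tendsto_of_le_of_le tendsto_const_nhds (htail g)
      (fun _ ↦ zero_le) fun n ↦ ?_
    dsimp only
    rw [← map_sub]
    exact (hC _).trans (mul_le_mul_right (eLpNorm_sub_truncation_le _ _ _ hfg n) _)

end Extension

end TentBound

theorem proposition4p1 {n : ℕ} {M : Type*} [MetricSpace M] [CompleteSpace M] [ConnectedSpace M]
    [SecondCountableTopology M]
    [ChartedSpace (EuclideanSpace ℝ (Fin n)) M] [IsManifold (𝓡 n) ∞ M]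
    [RiemannianBundle (fun x : M ↦ TangentSpace (𝓡 n) x)]
    [IsContMDiffRiemannianBundle (𝓡 n) ∞ (EuclideanSpace ℝ (Fin n))
      (fun x : M ↦ TangentSpace (𝓡 n) x)]
    [IsRiemannianManifold (𝓡 n) M]
    [MeasurableSpace M] [BorelSpace M]
    (hD : TentBound.IsDoubling (TentBound.riemannianMeasure n M))
    {𝕜 : Type*} [RCLike 𝕜]
    {H : Type*} [NormedAddCommGroup H] [InnerProductSpace 𝕜 H] [CompleteSpace H]
    (T : Lp 𝕜 2 (TentBound.riemannianMeasure n M) →ₗ[𝕜]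
      TentBound.TentFun H (TentBound.riemannianMeasure n M))
    (hT : TentBound.IsBoundedToTent T)
    (p α : ℝ) (hp : 2 < p) (hα : 1 < α)
    (hloc : TentBound.LocalEstimate T p α) :
    ∀ q : ℝ, 2 < q → q < p → TentBound.ExtendsBoundedly T (ENNReal.ofReal q) := by
  intro q hq hqp
  obtain ⟨D, hD⟩ := hD.exists_doublingWith
  have := hD.sigmaFinite
  obtain ⟨C, hC⟩ := hD.exists_tentNorm_le hT hp hα hloc hq hqp
  exact hD.extendsBoundedly hq.le hC
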